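/- **Definitions.** Let $g\ge 1$ be an integer, and let $n=2g+1$ or $n=2g+2$. For a prime $p$ and a monic integer polynomial $f$ of degree $n$ with $p^2\mid\Delta(f)$, say that $p^2$ *strongly divides* $\Delta(f)$ if $p^2\mid\Delta(f+ph)$ for every integer polynomial $h$ of degree $n$, and that $p^2$ *weakly divides* $\Delta(f)$ otherwise. For a squarefree positive integer $m$, let $\mathcal W_m^{(2)}$ be the set of monic integer polynomials $f$ of degree $n$ such that $p^2$ weakly divides $\Delta(f)$ for every prime $p\mid m$. Let $A_0$ be the $n\times n$ matrix with $1$'s on the anti-diagonal and $0$'s elsewhere. For a symmetric $n\times n$ rational matrix $B$, put $f_B(x)=(-1)^{n(n-1)/2}\det(A_0x-B)$ and $\Delta(B)=\Delta(f_B)$. Let $W_0$ be the space of symmetric $n\times n$ matrices whose top left $g\times(n-g-1)$ block is zero, and for a positive integer $d$ let $\frac1dW_0(\mathbb Z)$ be the set of $B\in W_0(\mathbb Q)$ such that $dB$ has integer entries. For a prime $p$ and $B\in\frac1dW_0(\mathbb Z)$, say that $p^2$ *strongly divides* $\Delta(B)$ on $\frac1dW_0(\mathbb Z)$ if $p^2$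 divides $\Delta(B)$ and $\Delta(B+pB')$ in $\mathbb Z_{(p)}$ for all $B'\in\frac1dW_0(\mathbb Z)$. For a pair $(A,B)$ of $g\times(g+1)$ matrices, let $M_i(x,y)$ ($1\le i\le g+1$) be $(-1)^{i-1}$ times the determinant of the matrix obtained from $Ax-By$ by deleting the $i$-th column; it is a binary form of degree $g$. Let $Q(A,B)$ be the determinant of the $(g+1)\times(g+1)$ matrix whose $i$-th row consists of the coefficients of $M_i$ at $x^ky^{g-k}$, $k=0,\dots,g$. For $B\in W_0(\mathbb Q)$ put $Q(B)=Q(A_0^{\mathrm{top}},B^{\mathrm{top}})$, where the superscript denotes the top right $g\times(g+1)$ block. For integers $c_1,\dots,c_n$, let $B_m(c_1,\dots,c_n)$ be the symmetric $n\times n$ matrix whose entries $(i,j)$ with $i\le j$ are zero except for the following: * the entry $(1,n-1)$ is $m$, and the entries $(i,n-i)$ with $2\le i\le n/2$ are $1$; * if $n=2g+1$: the entry $(g+1+k,g+1+k)$ is $-c_{2k+1}$ for $0\le k\le g$, and the entry $(g+1+k,g+2+k)$ is $-c_{2k+2}/2$ for $0\le k\le g-1$; * if $n=2g+2$: the entry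 $(g+2,g+2)$ is $c_1^2/4-c_2$, the entry $(g+2+k,g+2+k)$ is $-c_{2k+2}$ for $1\le k\le g$, and the entry $(g+1+k,g+2+k)$ is $-c_{2k+1}/2$ for $0\le k\le g$. **Theorem.** Let $g\ge1$, let $n=2g+1$ or $n=2g+2$, and let $m$ be a positive squarefree integer. Put $d=2$ if $n$ is odd and $d=4$ if $n$ is even. There is a map $\sigma_m:\mathcal W_m^{(2)}\to\frac1dW_0(\mathbb Z)$ such that for every $f\in\mathcal W_m^{(2)}$: 1. there are integers $\ell,c_1,\dots,c_n$ with $f(x+\ell)=x^n+c_1x^{n-1}+\cdots+c_{n-2}x^2+mc_{n-1}x+m^2c_n$ and $\sigma_m(f)=B_m(c_1,\dots,c_n)+\ell A_0$; 2. $f_{\sigma_m(f)}=f$; 3. $p^2$ strongly divides $\Delta(\sigma_m(f))$ on $\frac1dW_0(\mathbb Z)$ for every prime $p\mid m$; 4. $|Q(\sigma_m(f))|=m$. -/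

import Mathlib

open Polynomial

noncomputable section

namespace SquarefreeDisc

/-! ### Discriminants of integer polynomials -/

/-- `p ^ 2` strongly divides the discriminant of `f`: it divides the discriminant of `f + p g`
for every integer polynomial `g` of the same degree as `f`. -/
def StronglyDvdDisc (p : ℕ) (f : ℤ[X]) : Prop :=
  (p : ℤ) ^ 2 ∣ f.discr ∧
    ∀ h : ℤ[X], h.natDegree = f.natDegree → (p : ℤ) ^ 2 ∣ (f + C (p : ℤ) * h).discr

/-- `p ^ 2` weakly divides the discriminant of `f`: it divides it, but not strongly. -/
def WeaklyDvdDisc (p : ℕ) (f : ℤ[X]) : Prop :=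
  (p : ℤ) ^ 2 ∣ f.discr ∧ ¬ StronglyDvdDisc p f

/-- The monic integer polynomials of degree `n` whose discriminant is weakly divisible by `p ^ 2`
for every prime factor `p` of `m`. -/
def weakSet (n m : ℕ) : Set ℤ[X] :=
  {f | f.Monic ∧ f.natDegree = n ∧ ∀ p : ℕ, p.Prime → p ∣ m → WeaklyDvdDisc p f}

/-! ### Symmetric matrices and their invariant polynomials -/

/-- The `n × n` matrix with ones on the anti-diagonal and zeros elsewhere. -/
def antiDiag (n : ℕ) : Matrix (Fin n) (Fin n) ℚ :=
  Matrix.of fun i j => if i.val + j.val + 1 = n then 1 else 0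

/-- The invariant polynomial `f_B(x) = (-1)^{n(n-1)/2} det (A₀ x - B)`. -/
def invPoly {n : ℕ} (B : Matrix (Fin n) (Fin n) ℚ) : ℚ[X] :=
  (-1) ^ (n * (n - 1) / 2) * ((X : ℚ[X]) • (antiDiag n).map C - B.map C).det

/-- The discriminant of a matrix is the discriminant of its invariant polynomial. -/
def matDisc {n : ℕ} (B : Matrix (Fin n) (Fin n) ℚ) : ℚ := (invPoly B).discr

/-- The space `W₀(ℚ)`: symmetric `n × n` matrices whose top left `g × (n - (g + 1))` block
vanishes. This block is `g × g` for `n = 2 g + 1` and `g × (g + 1)` for `n = 2 g + 2`. -/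
def W0 (g n : ℕ) : Set (Matrix (Fin n) (Fin n) ℚ) :=
  {B | B.IsSymm ∧ ∀ i j : Fin n, i.val < g → j.val + (g + 1) < n → B i j = 0}

/-- The lattice `(1/d) W₀(ℤ)`: elements `B` of `W₀(ℚ)` such that `d B` has integer entries. -/
def W0Lattice (g n d : ℕ) : Set (Matrix (Fin n) (Fin n) ℚ) :=
  {B | B ∈ W0 g n ∧ ∀ i j : Fin n, ∃ z : ℤ, (d : ℚ) * B i j = z}

/-- Divisibility of a rational number by `p ^ 2` in the local ring `ℤ_(p)`: the number equals
`p ^ 2 * a / b` with integers `a`, `b` and `b` prime to `p`. -/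
def SqDvdAt (p : ℕ) (r : ℚ) : Prop :=
  ∃ a b : ℤ, ¬ (p : ℤ) ∣ b ∧ (b : ℚ) * r = (p : ℚ) ^ 2 * a

/-- `p ^ 2` strongly divides the discriminant of `B`, viewed as an element of the lattice `L`:
it divides the discriminant of `B + p B'` for every `B'` in `L`. -/
def StronglyDvdMatDisc {n : ℕ} (L : Set (Matrix (Fin n) (Fin n) ℚ)) (p : ℕ)
    (B : Matrix (Fin n) (Fin n) ℚ) : Prop :=
  SqDvdAt p (matDisc B) ∧ ∀ B' ∈ L, SqDvdAt p (matDisc (B + (p : ℚ) • B'))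

/-! ### The `Q`-invariant -/

/-- The `i`-th entry of the vector `M_v(x, y)` of signed `g × g` minors of `A x - B y`, for the
pair `v = (A, B)` of `g × (g + 1)` matrices. This is a binary form of degree `g`, written here in
the dehomogenized form `y = 1`: the coefficient of `x ^ k y ^ (g - k)` is the coefficient of
`X ^ k`. -/
def signedMinor {g : ℕ} (A B : Matrix (Fin g) (Fin (g + 1)) ℚ) (i : Fin (g + 1)) : ℚ[X] :=
  (-1) ^ i.val * (((X : ℚ[X]) • A.map C - B.map C).submatrix id i.succAbove).det

/-- The `Q`-invariant of a pair of `g × (g + 1)` matrices: the determinant of the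
`(g + 1) × (g + 1)` matrix of coefficients of the `g + 1` binary forms of degree `g` above. -/
def pairQ {g : ℕ} (A B : Matrix (Fin g) (Fin (g + 1)) ℚ) : ℚ :=
  (Matrix.of fun i k : Fin (g + 1) => (signedMinor A B i).coeff k.val).det

/-- The top right `g × (g + 1)` block of an `n × n` matrix. -/
def topRight {n : ℕ} (g : ℕ) (hn : g + 1 ≤ n) (B : Matrix (Fin n) (Fin n) ℚ) :
    Matrix (Fin g) (Fin (g + 1)) ℚ :=
  Matrix.of fun i j => B ⟨i.val, by omega⟩ ⟨n - (g + 1) + j.val, by omega⟩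

/-- The `Q`-invariant of an element `B` of `W₀`. -/
def matQ {n : ℕ} (g : ℕ) (hn : g + 1 ≤ n) (B : Matrix (Fin n) (Fin n) ℚ) : ℚ :=
  pairQ (topRight g hn (antiDiag n)) (topRight g hn B)

/-! ### The explicit matrices -/

/-- The polynomial `x^n + c₁ x^(n-1) + ⋯ + c_(n-2) x^2 + m c_(n-1) x + m^2 c_n`. -/
def normalForm (n m : ℕ) (c : ℕ → ℤ) : ℤ[X] :=
  X ^ n + ∑ i ∈ Finset.Icc 1 (n - 2), C (c i) * X ^ (n - i)
    + C ((m : ℤ) * c (n - 1)) * X + C ((m : ℤ) ^ 2 * c n)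

/-- The matrix `B_m(c₁, …, c_n)` for `n = 2 g + 1`. With rows and columns numbered from `1`, it is
symmetric, with `m` in position `(1, n - 1)`, ones in the other positions `(i, j)` with
`i + j = n` and `2 ≤ i ≤ j`, `-c_(2k+1)` in position `(g + 1 + k, g + 1 + k)` for `0 ≤ k ≤ g`,
`-c_(2k+2) / 2` in position `(g + 1 + k, g + 2 + k)` for `0 ≤ k < g`, and zeros elsewhere on and
above the diagonal. (The code numbers rows and columns from `0`.) -/
def oddMatrix (g m : ℕ) (c : ℕ → ℤ) : Matrix (Fin (2 * g + 1)) (Fin (2 * g + 1)) ℚ :=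
  Matrix.of fun i j =>
    let a := min i.val j.val
    let b := max i.val j.val
    if a + b + 2 = 2 * g + 1 then (if a = 0 then (m : ℚ) else 1)
    else if a = b ∧ g ≤ a then -(c (2 * (a - g) + 1) : ℚ)
    else if b = a + 1 ∧ g ≤ a then -(c (2 * (a - g) + 2) : ℚ) / 2
    else 0

/-- The matrix `B_m(c₁, …, c_n)` for `n = 2 g + 2`. With rows and columns numbered from `1`, it is
symmetric, with `m` in position `(1, n - 1)`, ones in the other positions `(i, j)` with
`i + j = n` and `2 ≤ i ≤ j`, `c₁ ^ 2 / 4 - c₂` in position `(g + 2, g + 2)`, `-c_(2k+2)` in position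
`(g + 2 + k, g + 2 + k)` for `1 ≤ k ≤ g`, `-c_(2k+1) / 2` in position `(g + 1 + k, g + 2 + k)` for
`0 ≤ k ≤ g`, and zeros elsewhere on and above the diagonal. (The code numbers rows and columns
from `0`.) -/
def evenMatrix (g m : ℕ) (c : ℕ → ℤ) : Matrix (Fin (2 * g + 2)) (Fin (2 * g + 2)) ℚ :=
  Matrix.of fun i j =>
    let a := min i.val j.val
    let b := max i.val j.val
    if a + b + 2 = 2 * g + 2 then (if a = 0 then (m : ℚ) else 1)
    else if a = b ∧ a = g + 1 then (c 1 : ℚ) ^ 2 / 4 - (c 2 : ℚ)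
    else if a = b ∧ g + 1 < a then -(c (2 * (a - g)) : ℚ)
    else if b = a + 1 ∧ g ≤ a then -(c (2 * (a - g) + 1) : ℚ) / 2
    else 0

end SquarefreeDisc

end

open Polynomial

noncomputable section

namespace SquarefreeDisc

/-! Weak divisibility at `p` comes from a double zero that is visible modulo `p ^ 2`. If `f` and
`f'` modulo `p` share a divisor of degree at least two, the Sylvester matrix of any integral lift
has corank at least two modulo `p`, so `p ^ 2` divides the discriminant of every `f + p h` and the
divisibility is strong. In the weak case the common divisor is therefore linear, with a zero `r` at
which `f''` does not vanish. This forces `p` to be odd, and a Newton step lifts `r` to `l` with `p ^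
2 ∣ f'(l)`. Modulo `p ^ 2` the resultant of `f` and `f'` is then `± f(l)` times a unit, hence `p ^ 2
∣ f(l)` (`exists_zero_of_weaklyDvdDisc`). The Chinese remainder theorem glues these zeros over the
primes dividing `m`, and translation by the result gives the normal form (`exists_normalForm`).

The matrices realize the normal form because the pencil `A₀ x - B_m` has a `g × (g + 1)` corner
block that kills `(x ^ g, …, x, m)`. Its determinant is, up to sign, the value at this vector of the
quadratic form of the tridiagonal block, and that value is the normal form (`det_borderEntry`). The
even size reduces to this shape by one pivot. Translation of `x` corresponds to adding a multiple of
`A₀`.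

Strong divisibility on the lattice holds because the first row of `B_m` is divisible by `p` and its
corner entry is zero. Both properties survive adding `p B'` with `B'` in the lattice, where `d` is a
`p`-adic unit. They force a zero of the invariant polynomial modulo `p ^ 2` at which the derivative
vanishes modulo `p`, hence `p ^ 2` divides the discriminant (`stronglyDvdMatDisc`). Finally, the
signed minors that define `Q` are, up to a common sign, the powers of `x - l` and the constant `m`,
so their coefficient matrix is triangular up to order (`abs_pairQ`). -/

/-! ### Corank two modulo `p` and squares dividing resultants -/

/-- Corank two makes the adjugate vanish modulo `p`, so it equals `p K` and `K M = d` with `det M =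
p d`. Applying `K M` to a kernel vector shows `p ∣ d`. -/
theorem sq_dvd_det_of_two_kernel_vectors {N : Type*} [Fintype N] [DecidableEq N] (p : ℕ)
    [Fact p.Prime] (M : Matrix N N ℤ) (a b : N → ZMod p)
    (hab : ∀ s t : ZMod p, s • a + t • b = 0 → s = 0 ∧ t = 0)
    (ha : (M.map (Int.castRingHom (ZMod p))).mulVec a = 0)
    (hb : (M.map (Int.castRingHom (ZMod p))).mulVec b = 0) : (p : ℤ) ^ 2 ∣ M.det := by
  have hp0 : (p : ℤ) ≠ 0 := by exact_mod_cast (Fact.out : p.Prime).ne_zero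
  have ha0 : a ≠ 0 := by
    rintro rfl
    simpa using (hab 1 0 (by simp)).1
  set M' := M.map (Int.castRingHom (ZMod p)) with hM'
  have hadj : ∀ i j, M'.adjugate i j = 0 := by
    intro i j
    rw [Matrix.adjugate_apply]
    -- A cofactor is the determinant after row `j` is replaced by a unit vector at `i`. A nonzero
    -- combination of `a` and `b` vanishing at `i` is in the kernel of that matrix too.
    obtain ⟨w, hw0, hwi, hwk⟩ : ∃ w : N → ZMod p, w ≠ 0 ∧ w i = 0 ∧ M'.mulVec w = 0 := by
      by_cases hai : a i = 0
      · exact ⟨a, ha0, hai, ha⟩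
      · refine ⟨(-b i) • a + a i • b, fun h => hai (hab _ _ h).2, ?_, ?_⟩
        · simp only [Pi.add_apply, Pi.smul_apply, smul_eq_mul]; ring
        · rw [Matrix.mulVec_add, Matrix.mulVec_smul, Matrix.mulVec_smul, ha, hb]; simp
    refine Matrix.exists_mulVec_eq_zero_iff.mp ⟨w, hw0, ?_⟩
    ext k
    by_cases hk : k = j
    · subst hk
      simp [Matrix.mulVec, hwi]
    · have := congrFun hwk k
      simpa [Matrix.mulVec, Matrix.updateRow_ne hk] using this
  have hdvd : ∀ i j, ∃ z : ℤ, M.adjugate i j = p * z := by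
    intro i j
    have h1 : (M.adjugate).map (Int.castRingHom (ZMod p)) = M'.adjugate :=
      RingHom.map_adjugate (Int.castRingHom (ZMod p)) M
    have h2 : ((M.adjugate i j : ℤ) : ZMod p) = 0 := by
      rw [← hadj i j, ← h1]; rfl
    exact (ZMod.intCast_zmod_eq_zero_iff_dvd _ _).mp h2
  choose K hK using hdvd
  have hKM : ∀ i j, (p : ℤ) * (Matrix.of K * M) i j = (M.det • (1 : Matrix N N ℤ)) i j := by
    intro i j
    rw [← Matrix.adjugate_mul, Matrix.mul_apply, Matrix.mul_apply, Finset.mul_sum]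
    refine Finset.sum_congr rfl fun k _ => ?_
    rw [hK]; simp [mul_assoc]
  obtain ⟨i, hi⟩ : ∃ i, a i ≠ 0 := by
    by_contra! h
    exact ha0 (funext h)
  obtain ⟨d, hd⟩ : ∃ d : ℤ, M.det = p * d := ⟨_, by simpa using (hKM i i).symm⟩
  have hKM' : Matrix.of K * M = d • (1 : Matrix N N ℤ) := by
    ext i j
    have := hKM i j
    rw [hd, mul_smul, Matrix.smul_apply, smul_eq_mul] at this
    exact mul_left_cancel₀ hp0 this
  have hd0 : ((d : ℤ) : ZMod p) = 0 := by
    have h1 : (Matrix.of K * M).map (Int.castRingHom (ZMod p)) =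
      (Matrix.of K).map (Int.castRingHom (ZMod p)) * M' := Matrix.map_mul
    have h2 : ((Matrix.of K * M).map (Int.castRingHom (ZMod p))).mulVec a = 0 := by
      rw [h1, ← Matrix.mulVec_mulVec, ha, Matrix.mulVec_zero]
    have h3 : (d • (1 : Matrix N N ℤ)).map (Int.castRingHom (ZMod p)) =
        (d : ZMod p) • (1 : Matrix N N (ZMod p)) := by
      ext i j
      rw [Matrix.map_apply, Matrix.smul_apply, Matrix.smul_apply, Matrix.one_apply,
        Matrix.one_apply]
      split_ifs <;> simp
    rw [hKM', h3, Matrix.smul_mulVec, Matrix.one_mulVec] at h2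
    have h4 := congrFun h2 i
    simpa [hi] using h4
  obtain ⟨e, he⟩ := (ZMod.intCast_zmod_eq_zero_iff_dvd _ _).mp hd0
  exact ⟨e, by rw [hd, he]; ring⟩

/-- Writing `f = D e` and `f' = D k`, each `s` of degree at most one gives the syzygy `(s e) f' - (s
k) f = 0`, which meets the Sylvester degree bounds since `deg D ≥ 2`. The choices `s = 1` and `s =
X` are two independent kernel vectors. -/
theorem sq_dvd_resultant_of_common_divisor (p : ℕ) [Fact p.Prime] (F : ℤ[X]) (n : ℕ)
    (hn : F.natDegree ≤ n) (hF : F.map (Int.castRingHom (ZMod p)) ≠ 0) (D : (ZMod p)[X])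
    (hD : 2 ≤ D.natDegree) (h1 : D ∣ F.map (Int.castRingHom (ZMod p)))
    (h2 : D ∣ derivative (F.map (Int.castRingHom (ZMod p)))) :
    (p : ℤ) ^ 2 ∣ resultant F (derivative F) n (n - 1) := by
  set f := F.map (Int.castRingHom (ZMod p)) with hf
  obtain ⟨e, he⟩ := h1
  obtain ⟨k, hk⟩ := h2
  have hfn : f.natDegree ≤ n := natDegree_map_le.trans hn
  have hfn' : (derivative f).natDegree ≤ n - 1 :=
    (natDegree_derivative_le f).trans (Nat.sub_le_sub_right hfn 1)
  have hD0 : D ≠ 0 := by rintro rfl; simp at hD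
  have he0 : e ≠ 0 := by rintro rfl; simp at he; exact hF he
  have hde : D.natDegree + e.natDegree ≤ n := by rwa [← natDegree_mul hD0 he0, ← he]
  have hmem1 : ∀ s : (ZMod p)[X], s.natDegree ≤ 1 → s * e ∈ degreeLT (ZMod p) n := by
    intro s hs
    rw [mem_degreeLT]
    refine degree_le_natDegree.trans_lt ?_
    have := natDegree_mul_le (p := s) (q := e)
    exact_mod_cast (by omega : (s * e).natDegree < n)
  have hmem2 : ∀ s : (ZMod p)[X], s.natDegree ≤ 1 → -(s * k) ∈ degreeLT (ZMod p) (n - 1) := by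
    intro s hs
    rw [mem_degreeLT]
    by_cases hk0 : k = 0
    · simp [hk0]
    · rw [degree_neg]
      refine degree_le_natDegree.trans_lt ?_
      have := natDegree_mul_le (p := s) (q := k)
      have h3 : D.natDegree + k.natDegree ≤ n - 1 := by rwa [← natDegree_mul hD0 hk0, ← hk]
      exact_mod_cast (by omega : (s * k).natDegree < n - 1)
  let x : (ZMod p)[X] → (degreeLT (ZMod p) n) × (degreeLT (ZMod p) (n - 1)) := fun s =>
    if hs : s.natDegree ≤ 1 then (⟨s * e, hmem1 s hs⟩, ⟨-(s * k), hmem2 s hs⟩) else 0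
  let b₁ := ((degreeLT.basis (ZMod p) n).prod (degreeLT.basis (ZMod p) (n - 1))).reindex
    finSumFinEquiv
  have hker : ∀ s : (ZMod p)[X], s.natDegree ≤ 1 →
      (sylvester f (derivative f) n (n - 1)).mulVec (b₁.repr (x s)) = 0 := by
    intro s hs
    rw [← toMatrix_sylvesterMap' f (derivative f) hfn hfn', LinearMap.toMatrix_mulVec_repr]
    have : sylvesterMap f (derivative f) hfn hfn' (x s) = 0 := by
      apply Subtype.ext
      simp only [sylvesterMap_apply_coe, x, dif_pos hs, ZeroMemClass.coe_zero]
      rw [hk, he]; ring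
    rw [this]; simp
  have hmap : sylvester f (derivative f) n (n - 1) =
      (sylvester F (derivative F) n (n - 1)).map (Int.castRingHom (ZMod p)) := by
    rw [hf, derivative_map, sylvester_map_map]; rfl
  have hx1 : (1 : (ZMod p)[X]).natDegree ≤ 1 := by simp
  have hx2 : (X : (ZMod p)[X]).natDegree ≤ 1 := natDegree_X_le
  refine sq_dvd_det_of_two_kernel_vectors p _ (b₁.repr (x 1)) (b₁.repr (x X)) ?_ ?_ ?_
  · intro s t hst
    have h3 : s • x 1 + t • x X = 0 := by
      apply b₁.repr.injective
      ext i
      simpa using congrFun hst i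
    simp only [x, dif_pos hx1, dif_pos hx2] at h3
    have h4 : s • (1 * e) + t • (X * e) = 0 := congrArg (fun z => (z.1 : (ZMod p)[X])) h3
    have h5 : (C s + C t * X) * e = 0 := by
      rw [← h4]
      simp [smul_eq_C_mul]; ring
    have h6 := (mul_eq_zero.mp h5).resolve_right he0
    constructor
    · simpa using congrArg (coeff · 0) h6
    · simpa using congrArg (coeff · 1) h6
  · rw [← hmap]; exact hker 1 hx1
  · rw [← hmap]; exact hker X hx2

/-! ### Resultants with a linear factor -/

/-- `Res(f, (X - a) k) = ± f(a) Res(f, k)` for formal degrees. -/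
theorem resultant_X_sub_C_mul_right {R : Type*} [CommRing R] (f k : R[X]) (a : R) (m d : ℕ)
    (hf : f.natDegree ≤ m) (hk : k.natDegree ≤ d) :
    resultant f ((X - C a) * k) m (1 + d) = (-1) ^ m * f.eval a * resultant f k m d := by
  nontriviality R
  obtain ⟨t, rfl⟩ := Nat.exists_eq_add_of_le hk
  have h1 := resultant_mul_right f (X - C a) k m hf
  rw [natDegree_X_sub_C] at h1
  have h2 : ((X - C a) * k).natDegree ≤ 1 + k.natDegree := by
    have := natDegree_mul_le (p := X - C a) (q := k)
    rwa [natDegree_X_sub_C] at this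
  rw [← add_assoc, resultant_add_right_deg _ _ _ _ _ h2, h1,
    resultant_add_right_deg _ _ _ _ _ le_rfl, resultant_X_sub_C_right _ _ _ hf]
  ring

theorem resultant_X_sub_C_mul_left {R : Type*} [CommRing R] (f k : R[X]) (a : R) (m d : ℕ)
    (hf : f.natDegree ≤ m) (hk : k.natDegree ≤ d) :
    resultant ((X - C a) * k) f (1 + d) m = f.eval a * resultant k f d m := by
  rw [resultant_comm, resultant_X_sub_C_mul_right f k a m d hf hk, resultant_comm k f]
  have : ((-1 : R) ^ m) * (-1) ^ m = 1 := by rw [← mul_pow]; simp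
  have h2 : (-1 : R) ^ ((1 + d) * m) = (-1) ^ m * (-1) ^ (d * m) := by
    rw [← pow_add]; ring_nf
  rw [h2]
  linear_combination ((-1) ^ (d * m) * f.eval a * resultant f k m d) * this

/-- A polynomial with a double zero, up to nilpotents, has zero discriminant. -/
theorem resultant_derivative_eq_zero {R : Type*} [CommRing R] (F : R[X]) (l : R) (n : ℕ)
    (hn : 2 ≤ n) (hF : F.natDegree ≤ n) (h0 : F.eval l = 0)
    (h1 : (derivative F).eval l ^ 2 = 0) : resultant F (derivative F) n (n - 1) = 0 := by
  obtain ⟨k, hk⟩ := dvd_iff_isRoot.mpr h0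
  nontriviality R
  have hkd : k.natDegree ≤ n - 1 := by
    by_cases hk0 : k = 0
    · simp [hk0]
    · have : F.natDegree = 1 + k.natDegree := by
        rw [hk, (monic_X_sub_C l).natDegree_mul' hk0, natDegree_X_sub_C]
      omega
  have hder : derivative F = (X - C l) * derivative k + k * 1 := by
    rw [hk]; simp; ring
  have hkl : k.eval l = (derivative F).eval l := by rw [hder]; simp
  have hFd : (derivative F).natDegree ≤ n - 1 :=
    (natDegree_derivative_le F).trans (Nat.sub_le_sub_right hF 1)
  have hkd' : (derivative k).natDegree ≤ n - 2 :=
    (natDegree_derivative_le k).trans (by omega)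
  have e1 : n = 1 + (n - 1) := by omega
  -- With `F = (X - l) k` and `F' = k + (X - l) k'`, pulling out the linear factor twice gives `±
  -- F'(l) k(l) Res(k, k')`, and `k(l) = F'(l)`.
  have e2 : resultant F (derivative F) n (n - 1) =
      (derivative F).eval l * resultant k (derivative F) (n - 1) (n - 1) := by
    rw [← resultant_X_sub_C_mul_left _ _ _ _ _ hFd hkd, ← hk, ← e1]
  have e3 : resultant k (derivative F) (n - 1) (n - 1) =
      (-1) ^ (n - 1) * k.eval l * resultant k (derivative k) (n - 1) (n - 2) := by
    rw [hder, resultant_add_mul_right _ _ _ _ _ (by simp) hkd,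
      ← resultant_X_sub_C_mul_right _ _ _ _ _ hkd hkd']
    congr 1; omega
  rw [e2, e3, hkl]
  linear_combination ((-1) ^ (n - 1) * resultant k (derivative k) (n - 1) (n - 2)) * h1

/-! ### Weak divisibility at one prime -/

theorem exists_common_root_of_resultant_eq_zero {K : Type*} [Field K] {f g : K[X]} {d : ℕ}
    (hf : f.Monic) (hg : g.natDegree ≤ d) (h : resultant f g f.natDegree d = 0)
    (H : ∀ D : K[X], D ∣ f → D ∣ g → D.natDegree ≤ 1) :
    ∃ r, f.eval r = 0 ∧ g.eval r = 0 := by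
  classical
  obtain ⟨t, rfl⟩ := Nat.exists_eq_add_of_le hg
  rw [resultant_add_right_deg _ _ _ _ _ le_rfl, coeff_natDegree, hf.leadingCoeff, one_pow,
    one_mul, resultant_eq_zero_iff] at h
  have h1 : ¬ IsUnit (EuclideanDomain.gcd f g) := fun hu =>
    h.2 (EuclideanDomain.gcd_isUnit_iff.mp hu)
  have hDf := EuclideanDomain.gcd_dvd_left f g
  have hDg := EuclideanDomain.gcd_dvd_right f g
  set D := EuclideanDomain.gcd f g
  have hD0 : D ≠ 0 := by
    intro h0
    rw [h0, zero_dvd_iff] at hDf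
    exact hf.ne_zero hDf
  have hD1 : D.natDegree ≠ 0 := by
    intro h0
    rw [natDegree_eq_zero] at h0
    obtain ⟨c, hc⟩ := h0
    apply h1
    rw [← hc] at hD0 ⊢
    exact isUnit_C.mpr (isUnit_iff_ne_zero.mpr (by simpa using hD0))
  have hD2 : D.degree = 1 := by
    rw [degree_eq_natDegree hD0]
    have := H D hDf hDg
    exact_mod_cast (by omega : D.natDegree = 1)
  obtain ⟨r, hr⟩ := exists_root_of_degree_eq_one hD2
  exact ⟨r, (hr.dvd hDf : IsRoot f r), (hr.dvd hDg : IsRoot g r)⟩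

/-- The resultant of `F` and `F'` is the discriminant up to sign and the leading coefficient, a unit
at `p`. The formal degree of `F'` stays fixed, so the resultant is compatible with reduction even
when `F'` drops degree modulo `p`. -/
theorem sq_dvd_discr_iff {p : ℕ} (hp : p.Prime) {F : ℤ[X]} (hF : 0 < F.natDegree)
    (hlc : ¬ (p : ℤ) ∣ F.leadingCoeff) :
    (p : ℤ) ^ 2 ∣ F.discr ↔
      (p : ℤ) ^ 2 ∣ resultant F (derivative F) F.natDegree (F.natDegree - 1) := by
  rw [resultant_deriv (natDegree_pos_iff_degree_pos.mp hF), mul_assoc]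
  have hu : IsUnit ((-1 : ℤ) ^ (F.natDegree * (F.natDegree - 1) / 2)) := isUnit_one.neg.pow _
  rw [hu.dvd_mul_left]
  have hc : IsCoprime ((p : ℤ) ^ 2) F.leadingCoeff :=
    ((Nat.prime_iff_prime_int.mp hp).irreducible.coprime_iff_not_dvd.mpr hlc).pow_left
  exact ⟨fun h => h.mul_left _, fun h => hc.dvd_of_dvd_mul_left h⟩

/-- The reduction of `f + p h` is that of `f`, so a common divisor of degree two would force `p ^ 2`
to divide its discriminant as well. -/
theorem natDegree_common_divisor_le_one {p : ℕ} [Fact p.Prime] {f h : ℤ[X]} (hf : f.Monic)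
    (hn : 0 < f.natDegree) (hh : h.natDegree = f.natDegree)
    (hnd : ¬ (p : ℤ) ^ 2 ∣ (f + C (p : ℤ) * h).discr) (D : (ZMod p)[X])
    (h1 : D ∣ f.map (Int.castRingHom (ZMod p)))
    (h2 : D ∣ derivative (f.map (Int.castRingHom (ZMod p)))) : D.natDegree ≤ 1 := by
  have hp : p.Prime := Fact.out
  have hpp := Nat.prime_iff_prime_int.mp hp
  by_contra! hD
  set F := f + C (p : ℤ) * h with hF
  -- `F` need not be monic, but its top coefficient is `1` modulo `p`, so the degree is kept.
  have hcoeff : F.coeff f.natDegree = 1 + p * h.coeff f.natDegree := by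
    simp [hF, hf]
  have hlc' : ¬ (p : ℤ) ∣ F.coeff f.natDegree := by
    rw [hcoeff]
    intro hd
    exact hpp.not_isUnit (isUnit_of_dvd_one ((dvd_add_left (Dvd.intro _ rfl)).mp hd))
  have hdeg : F.natDegree = f.natDegree := by
    refine natDegree_eq_of_le_of_coeff_ne_zero ?_ ?_
    · exact natDegree_add_le_of_degree_le le_rfl ((natDegree_C_mul_le _ _).trans hh.le)
    · intro h0
      exact hlc' (h0 ▸ dvd_zero _)
  have hmap : F.map (Int.castRingHom (ZMod p)) = f.map (Int.castRingHom (ZMod p)) := by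
    simp [hF]
  have hne : F.map (Int.castRingHom (ZMod p)) ≠ 0 := by
    rw [hmap]; exact (hf.map _).ne_zero
  rw [← hmap] at h1 h2
  refine hnd ((sq_dvd_discr_iff hp (by omega) (by rwa [leadingCoeff, hdeg])).mpr ?_)
  exact sq_dvd_resultant_of_common_divisor p F _ le_rfl hne D hD h1 h2

theorem eval_map_intCast {R : Type*} [CommRing R] (f : ℤ[X]) (a : ℤ) :
    (f.map (Int.castRingHom R)).eval (a : R) = ((f.eval a : ℤ) : R) := by
  simp

/-- The common zero of `f` and `f'` modulo `p` is a simple zero of `f'`. It therefore lifts to a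
zero `l` of `f'` modulo `p ^ 2`, and comparison with the resultant puts the whole factor `p ^ 2`
into `f(l)`. -/
theorem exists_zero_of_weaklyDvdDisc {p : ℕ} (hp : p.Prime) {f : ℤ[X]} (hf : f.Monic)
    (hn : 2 ≤ f.natDegree) (hw : WeaklyDvdDisc p f) :
    p ≠ 2 ∧ ∃ l : ℤ, (p : ℤ) ^ 2 ∣ f.eval l ∧ (p : ℤ) ∣ (derivative f).eval l := by
  have := Fact.mk hp
  have hpp := Nat.prime_iff_prime_int.mp hp
  have hlc : ¬ (p : ℤ) ∣ f.leadingCoeff := by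
    rw [hf.leadingCoeff]; exact fun h => hpp.not_isUnit (isUnit_of_dvd_one h)
  obtain ⟨hdvd, hns⟩ := hw
  obtain ⟨h, hh, hnd⟩ : ∃ h : ℤ[X], h.natDegree = f.natDegree ∧
      ¬ (p : ℤ) ^ 2 ∣ (f + C (p : ℤ) * h).discr := by
    by_contra! hc
    exact hns ⟨hdvd, hc⟩
  rw [sq_dvd_discr_iff hp (by omega) hlc] at hdvd
  set φ := Int.castRingHom (ZMod p) with hφ
  have H := natDegree_common_divisor_le_one hf (by omega) hh hnd
  set fb := f.map φ with hfb
  have hfbm : fb.Monic := hf.map φ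
  have hfbn : fb.natDegree = f.natDegree := hf.natDegree_map φ
  -- Otherwise `(X - a)(X - b)` divides both `f` and `f'` modulo `p`, against `H`. For `a = b` the
  -- double factor of `f` comes from `f(a) = f'(a) = 0`.
  have hsq : ∀ a : ZMod p, ∀ k : (ZMod p)[X], fb.eval a = 0 →
      derivative fb = (X - C a) * k → ∀ b, fb.eval b = 0 → k.eval b ≠ 0 := by
    intro a k ha hk b hb hkb
    obtain ⟨k', hk'⟩ := dvd_iff_isRoot.mpr hkb
    have hd : (X - C a) * (X - C b) ∣ derivative fb := ⟨k', by rw [hk, hk']; ring⟩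
    have hd' : (X - C a) * (X - C b) ∣ fb := by
      by_cases hab : a = b
      · subst hab
        obtain ⟨u, hu⟩ := dvd_iff_isRoot.mpr ha
        have : u.eval a = 0 := by
          have h3 : derivative fb = u + (X - C a) * derivative u := by rw [hu]; simp
          have h4 : (derivative fb).eval a = 0 := by rw [hk]; simp
          rw [h3] at h4
          simpa using h4
        obtain ⟨w, hw⟩ := dvd_iff_isRoot.mpr this
        exact ⟨w, by rw [hu, hw]; ring⟩
      · exact (isCoprime_X_sub_C_of_isUnit_sub (isUnit_iff_ne_zero.mpr (sub_ne_zero.mpr hab))).mul_dvd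
          (dvd_iff_isRoot.mpr ha) (dvd_iff_isRoot.mpr hb)
    have := H _ hd' hd
    rw [natDegree_mul (X_sub_C_ne_zero a) (X_sub_C_ne_zero b)] at this
    simp at this
  obtain ⟨r, hr, hr'⟩ : ∃ r, fb.eval r = 0 ∧ (derivative fb).eval r = 0 := by
    refine exists_common_root_of_resultant_eq_zero (d := f.natDegree - 1) hfbm
      (hfbn ▸ natDegree_derivative_le fb) ?_ H
    rw [hfbn, hfb, derivative_map, resultant_map_map]
    exact (ZMod.intCast_zmod_eq_zero_iff_dvd _ _).mpr ((dvd_pow_self _ two_ne_zero).trans hdvd)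
  have hr'' : (derivative (derivative fb)).eval r ≠ 0 := by
    obtain ⟨k, hk⟩ := dvd_iff_isRoot.mpr hr'
    have := hsq r k hr hk r hr
    rw [hk]
    simpa using this
  obtain ⟨t, rfl⟩ := ZMod.intCast_surjective r
  have hev : ∀ q : ℤ[X], (q.map φ).eval (t : ZMod p) = ((q.eval t : ℤ) : ZMod p) :=
    fun q => eval_map_intCast q t
  rw [hfb, derivative_map, derivative_map, hev, Ne, ZMod.intCast_zmod_eq_zero_iff_dvd] at hr''
  rw [hfb, derivative_map, hev, ZMod.intCast_zmod_eq_zero_iff_dvd] at hr'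
  refine ⟨?_, ?_⟩
  · rintro rfl
    apply hr''
    -- `f''` is twice the second Hasse derivative, so it vanishes modulo `2`.
    have h2 := factorial_smul_hasseDeriv (R := ℤ) 2
    have h3 : (derivative (derivative f)) = (2 : ℕ) • hasseDeriv 2 f := by
      have := congrFun h2 f
      simpa using this.symm
    rw [h3]
    simp
  obtain ⟨a, ha⟩ := hr'
  obtain ⟨u, v, huv⟩ := (hpp.irreducible.coprime_iff_not_dvd.mpr hr'')
  obtain ⟨l, hl, hlt⟩ : ∃ l : ℤ, (p : ℤ) ^ 2 ∣ (derivative f).eval l ∧ ((l : ℤ) : ZMod p) = t := by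
    -- Newton step for `f'`: here `f'(t) = p a`, and `v` inverts `f''(t)` modulo `p`.
    refine ⟨t + p * (-a * v), ?_, by simp⟩
    obtain ⟨k, hk⟩ := binomExpansion (derivative f) t (p * (-a * v))
    rw [hk, ha]
    refine ⟨a * u + k * (a * v) ^ 2, ?_⟩
    linear_combination (-(p : ℤ) * a) * huv
  refine ⟨l, ?_, (dvd_pow_self _ two_ne_zero).trans hl⟩
  obtain ⟨k, hk⟩ : (X - C l) ∣ derivative f - C ((derivative f).eval l) :=
    X_sub_C_dvd_sub_C_eval
  have hfd := natDegree_derivative_le f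
  have hkd : k.natDegree ≤ f.natDegree - 2 := by
    by_cases hk0 : k = 0
    · simp [hk0]
    · have h1 := congrArg natDegree hk
      rw [natDegree_sub_C, (monic_X_sub_C l).natDegree_mul' hk0, natDegree_X_sub_C] at h1
      omega
  -- A common zero of `f` and `k` modulo `p` is excluded by `hsq`, since `f' = (X - l) k` there.
  have hkp : ¬ (p : ℤ) ∣ resultant f k f.natDegree (f.natDegree - 2) := by
    intro hd
    have hder : derivative fb = (X - C ((l : ℤ) : ZMod p)) * k.map φ := by
      have := congrArg (map φ) hk
      have h0 : (((derivative f).eval l : ℤ) : ZMod p) = 0 :=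
        (ZMod.intCast_zmod_eq_zero_iff_dvd _ _).mpr ((dvd_pow_self _ two_ne_zero).trans hl)
      rw [Polynomial.map_sub, Polynomial.map_mul, Polynomial.map_sub, map_C, map_C, map_X,
        ← derivative_map, eq_intCast, eq_intCast, h0, C_0, sub_zero] at this
      exact this
    obtain ⟨s, hs, hs'⟩ : ∃ s, fb.eval s = 0 ∧ (k.map φ).eval s = 0 := by
      refine exists_common_root_of_resultant_eq_zero (d := f.natDegree - 2) hfbm
        (natDegree_map_le.trans hkd) ?_ ?_
      · rw [hfbn, hfb, resultant_map_map]
        exact (ZMod.intCast_zmod_eq_zero_iff_dvd _ _).mpr hd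
      · intro D h1 h2
        exact H D h1 (hder ▸ h2.mul_left _)
    exact hsq _ _ (hlt ▸ hr) hder s hs hs'
  have hres : (p : ℤ) ^ 2 ∣ (-1) ^ f.natDegree * f.eval l *
      resultant f k f.natDegree (f.natDegree - 2) := by
    rw [← resultant_X_sub_C_mul_right f k l _ _ le_rfl hkd, ← hk,
      show 1 + (f.natDegree - 2) = f.natDegree - 1 by omega]
    -- Dropping the constant `f'(l)` from `f'` does not change the resultant modulo `p ^ 2`.
    have hcast : ((p : ℤ) ^ 2) = ((p ^ 2 : ℕ) : ℤ) := by push_cast; rfl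
    rw [hcast] at hdvd hl ⊢
    rw [← ZMod.intCast_zmod_eq_zero_iff_dvd] at hdvd hl ⊢
    rw [← hdvd]
    change (Int.castRingHom (ZMod (p ^ 2))) _ = (Int.castRingHom (ZMod (p ^ 2))) _
    rw [← resultant_map_map, ← resultant_map_map]
    rw [Polynomial.map_sub, map_C, eq_intCast, hl, C_0, sub_zero]
  have hc : IsCoprime ((p : ℤ) ^ 2) (resultant f k f.natDegree (f.natDegree - 2)) :=
    (hpp.irreducible.coprime_iff_not_dvd.mpr hkp).pow_left
  have h5 := hc.dvd_of_dvd_mul_right hres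
  have hu : IsUnit ((-1 : ℤ) ^ f.natDegree) := isUnit_one.neg.pow _
  exact hu.dvd_mul_left.mp h5

/-! ### Normal form by the Chinese remainder theorem -/

theorem exists_eq_normalForm {m n : ℕ} (hn : 3 ≤ n) {F : ℤ[X]} (hF : F.Monic)
    (hFn : F.natDegree = n) (h0 : (m : ℤ) ^ 2 ∣ F.coeff 0) (h1 : (m : ℤ) ∣ F.coeff 1) :
    ∃ c : ℕ → ℤ, F = normalForm n m c := by
  obtain ⟨u, hu⟩ := h0
  obtain ⟨v, hv⟩ := h1
  obtain ⟨c, hc, hc', hc''⟩ : ∃ c : ℕ → ℤ, c n = u ∧ c (n - 1) = v ∧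
      ∀ i, i ≤ n - 2 → c i = F.coeff (n - i) := by
    refine ⟨fun i => if i = n then u else if i = n - 1 then v else F.coeff (n - i), by simp,
      ?_, fun i hi => ?_⟩
    · simp; omega
    · simp only
      rw [if_neg (by omega), if_neg (by omega)]
  refine ⟨c, ?_⟩
  have hlast : F.coeff n = 1 := by rw [← hFn]; exact hF
  have hsum : F = ∑ i ∈ Finset.range (n + 1), C (F.coeff i) * X ^ i :=
    F.as_sum_range_C_mul_X_pow' (by omega)
  obtain ⟨k, rfl⟩ := Nat.exists_eq_add_of_le' hn
  have h3 : ∑ i ∈ Finset.Icc 1 (k + 3 - 2), C (c i) * (X : ℤ[X]) ^ (k + 3 - i) =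
      ∑ i ∈ Finset.range (k + 1), C (F.coeff (i + 1 + 1)) * X ^ (i + 1 + 1) := by
    refine Finset.sum_nbij' (fun i => k + 1 - i) (fun i => k + 1 - i) ?_ ?_ ?_ ?_ ?_
    · intro i hi; simp only [Finset.mem_Icc, Finset.mem_range] at *; omega
    · intro i hi; simp only [Finset.mem_Icc, Finset.mem_range] at *; omega
    · intro i hi; simp only [Finset.mem_Icc] at *; omega
    · intro i hi; simp only [Finset.mem_range] at *; omega
    · intro i hi
      simp only [Finset.mem_Icc] at hi
      rw [hc'' i (by omega), show k + 1 - i + 1 + 1 = k + 3 - i by omega]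
  rw [Finset.sum_range_succ, hlast, Finset.sum_range_succ', Finset.sum_range_succ', ← h3, hu,
    zero_add, hv] at hsum
  rw [normalForm, hc, hc']
  refine hsum.trans ?_
  rw [pow_zero, pow_one, C_1]
  ring

/-- After translation by `l` the two lowest coefficients are `f(l)` and `f'(l)`, so it suffices to
glue the zeros found at the primes dividing `m`. -/
theorem exists_normalForm {m n : ℕ} (hm : Squarefree m) (hn : 3 ≤ n) {f : ℤ[X]}
    (hf : f ∈ weakSet n m) :
    ∃ (l : ℤ) (c : ℕ → ℤ), f.comp (X + C l) = normalForm n m c := by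
  obtain ⟨hmon, hdeg, hw⟩ := hf
  have hl : ∃ l : ℤ, (m : ℤ) ^ 2 ∣ f.eval l ∧ (m : ℤ) ∣ (derivative f).eval l := by
    have key : ∀ k : ℕ, k ∣ m → ∃ l : ℤ, (k : ℤ) ^ 2 ∣ f.eval l ∧ (k : ℤ) ∣ (derivative f).eval l := by
      intro k
      induction k using Nat.recOnPrimeCoprime with
      | zero =>
        intro h0
        exact absurd (Nat.eq_zero_of_zero_dvd h0) hm.ne_zero
      | prime_pow p j hp =>
        intro hk
        have hj : j ≤ 1 := by
          by_contra! hj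
          have h2 : p * p ∣ m := (pow_two p ▸ pow_dvd_pow p hj).trans hk
          exact hp.not_isUnit (hm p h2)
        interval_cases j
        · exact ⟨0, by simp, by simp⟩
        · rw [pow_one] at hk ⊢
          exact (exists_zero_of_weaklyDvdDisc hp hmon (by omega) (hw p hp hk)).2
      | coprime a b ha hb hab iha ihb =>
        intro hk
        obtain ⟨x, hx, hx'⟩ := iha (dvd_of_mul_right_dvd hk)
        obtain ⟨y, hy, hy'⟩ := ihb (dvd_of_mul_left_dvd hk)
        -- Gluing is done modulo `a ^ 2` and `b ^ 2`, as required for the values of `f`.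
        have hcop : IsCoprime ((a : ℤ) ^ 2) ((b : ℤ) ^ 2) := (Nat.isCoprime_iff_coprime.mpr hab).pow
        obtain ⟨u, v, huv⟩ := id hcop
        have h1 : (a : ℤ) ^ 2 ∣ (y * u * a ^ 2 + x * v * b ^ 2) - x :=
          ⟨(y - x) * u, by linear_combination x * huv⟩
        have h2 : (b : ℤ) ^ 2 ∣ (y * u * a ^ 2 + x * v * b ^ 2) - y :=
          ⟨(x - y) * v, by linear_combination y * huv⟩
        set z := y * u * a ^ 2 + x * v * b ^ 2
        have aux : ∀ (q : ℤ[X]) (d z x : ℤ), d ∣ z - x → d ∣ q.eval x → d ∣ q.eval z := by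
          intro q d z x hd hq
          have := hd.trans (sub_dvd_eval_sub z x q)
          exact (dvd_iff_dvd_of_dvd_sub this).mpr hq
        refine ⟨z, ?_, ?_⟩
        · push_cast
          rw [mul_pow]
          exact hcop.mul_dvd (aux _ _ _ _ h1 hx) (aux _ _ _ _ h2 hy)
        · push_cast
          exact (Nat.isCoprime_iff_coprime.mpr hab).mul_dvd
            (aux _ _ _ _ ((dvd_pow_self _ two_ne_zero).trans h1) hx')
            (aux _ _ _ _ ((dvd_pow_self _ two_ne_zero).trans h2) hy')
    exact key m dvd_rfl
  obtain ⟨l, ⟨u, hu⟩, ⟨v, hv⟩⟩ := hl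
  set F := f.comp (X + C l) with hF
  have hFm : F.Monic := hmon.comp_X_add_C l
  have hFn : F.natDegree = n := by
    rw [hF, natDegree_comp, natDegree_X_add_C, mul_one, hdeg]
  have hF0 : F.coeff 0 = (m : ℤ) ^ 2 * u := by
    rw [coeff_zero_eq_eval_zero, hF, ← hu]; simp
  have hF1 : F.coeff 1 = m * v := by
    have h1 : F.coeff 1 = (derivative F).eval 0 := by
      rw [← coeff_zero_eq_eval_zero, coeff_derivative]; simp
    rw [h1, hF, ← hv, derivative_comp]; simp
  obtain ⟨c, hc⟩ := exists_eq_normalForm hn hFm hFn ⟨u, hF0⟩ ⟨v, hF1⟩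
  exact ⟨l, c, hc⟩

/-! ### The invariant polynomial as a characteristic polynomial -/

theorem antiDiag_apply (n : ℕ) (i j : Fin n) :
    antiDiag n i j = if i.rev = j then 1 else 0 := by
  rw [antiDiag, Matrix.of_apply]
  congr 1
  rw [Fin.ext_iff, Fin.val_rev, eq_iff_iff]
  omega

theorem antiDiag_mul_apply {n : ℕ} (B : Matrix (Fin n) (Fin n) ℚ) (i j : Fin n) :
    (antiDiag n * B) i j = B i.rev j := by
  simp [Matrix.mul_apply, antiDiag_apply]

theorem antiDiag_mul_self (n : ℕ) : antiDiag n * antiDiag n = 1 := by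
  ext i j
  rw [antiDiag_mul_apply, antiDiag_apply, Fin.rev_rev, Matrix.one_apply]

theorem det_antiDiag (n : ℕ) : (antiDiag n).det = (-1) ^ (n * (n - 1) / 2) := by
  induction n with
  | zero => simp
  | succ n ih =>
    rw [Matrix.det_succ_row_zero, Finset.sum_eq_single (Fin.last n)]
    · have h1 : (antiDiag (n + 1)).submatrix Fin.succ (Fin.last n).succAbove = antiDiag n := by
        ext i j
        simp only [antiDiag, Matrix.submatrix_apply, Matrix.of_apply, Fin.succAbove_last,
          Fin.val_succ, Fin.val_castSucc]
        congr 1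
        rw [eq_iff_iff]; omega
      rw [h1, ih, antiDiag_apply]
      have h2 : (n + 1) * (n + 1 - 1) / 2 = n + n * (n - 1) / 2 := by
        rw [Nat.triangle_succ, add_comm]
      rw [h2, pow_add]
      simp
    · intro j _ hj
      rw [antiDiag_apply, if_neg]
      · simp
      · simpa [eq_comm] using hj
    · simp

/-- `A₀` is an involution whose determinant is exactly the sign in the definition. Adding `l A₀` to
`B` thus becomes adding the scalar `l` to `A₀ B`. -/
theorem invPoly_eq_charpoly {n : ℕ} (B : Matrix (Fin n) (Fin n) ℚ) :
    invPoly B = (antiDiag n * B).charpoly := by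
  have h : (antiDiag n * B).charmatrix =
      (antiDiag n).map C * ((X : ℚ[X]) • (antiDiag n).map C - B.map C) := by
    have h1 : (antiDiag n).map (C : ℚ →+* ℚ[X]) * (antiDiag n).map C = 1 := by
      rw [← Matrix.map_mul, antiDiag_mul_self]; simp
    rw [Matrix.charmatrix, RingHom.mapMatrix_apply, Matrix.map_mul, Matrix.mul_sub,
      Matrix.mul_smul, h1]
    congr 1
    ext i j; simp [Matrix.diagonal_apply, Matrix.smul_apply, Matrix.one_apply]
  rw [Matrix.charpoly, h, Matrix.det_mul, invPoly]
  congr 1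
  have := (RingHom.map_det (C : ℚ →+* ℚ[X]) (antiDiag n)).symm
  rw [RingHom.mapMatrix_apply] at this
  rw [this, det_antiDiag]
  simp

theorem invPoly_add_smul_antiDiag {n : ℕ} (B : Matrix (Fin n) (Fin n) ℚ) (l : ℚ) :
    invPoly (B + l • antiDiag n) = (invPoly B).comp (X - C l) := by
  rw [invPoly_eq_charpoly, invPoly_eq_charpoly, Matrix.mul_add, Matrix.mul_smul,
    antiDiag_mul_self]
  have h := Matrix.charpoly_sub_scalar (antiDiag n * B) (-l)
  rw [C_neg, ← sub_eq_add_neg] at h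
  rw [← h]
  congr 1
  ext i j
  by_cases h : i = j <;> simp [h]

/-! ### Strong divisibility on the lattice -/

/-- The local ring `ℤ_(p)` as a subring of the rational numbers. -/
def localSubring {p : ℕ} (hp : p.Prime) : Subring ℚ where
  carrier := {r | ∃ a b : ℤ, ¬ (p : ℤ) ∣ b ∧ (b : ℚ) * r = a}
  mul_mem' := by
    rintro r s ⟨a, b, hb, h⟩ ⟨a', b', hb', h'⟩
    refine ⟨a * a', b * b', (Nat.prime_iff_prime_int.mp hp).not_dvd_mul hb hb', ?_⟩
    push_cast; rw [← h, ← h']; ring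
  one_mem' := ⟨1, 1, fun h => (Nat.prime_iff_prime_int.mp hp).not_isUnit (isUnit_of_dvd_one h),
    by simp⟩
  add_mem' := by
    rintro r s ⟨a, b, hb, h⟩ ⟨a', b', hb', h'⟩
    refine ⟨b' * a + b * a', b * b', (Nat.prime_iff_prime_int.mp hp).not_dvd_mul hb hb', ?_⟩
    push_cast; rw [← h, ← h']; ring
  zero_mem' := ⟨0, 1, fun h => (Nat.prime_iff_prime_int.mp hp).not_isUnit (isUnit_of_dvd_one h),
    by simp⟩
  neg_mem' := by
    rintro r ⟨a, b, hb, h⟩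
    exact ⟨-a, b, hb, by push_cast; rw [← h]; ring⟩

/-- A Leibniz term either contains the zero entry at `(r, c)` or has two different factors, one from
row `r` and one from column `c`. -/
theorem det_mem_sq {R ι : Type*} [CommRing R] [Fintype ι] [DecidableEq ι] (I : Ideal R)
    (M : Matrix ι ι R) (r c : ι) (h0 : M r c = 0) (hr : ∀ j, M r j ∈ I) (hc : ∀ i, M i c ∈ I) :
    M.det ∈ I ^ 2 := by
  rw [Matrix.det_apply]
  refine Ideal.sum_mem _ fun s _ => ?_
  refine Submodule.smul_of_tower_mem _ _ ?_
  by_cases hs : s c = r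
  · rw [Finset.prod_eq_zero (Finset.mem_univ c) (by rw [hs, h0])]
    exact Ideal.zero_mem _
  · have h1 : s⁻¹ r ≠ c := by
      rintro rfl; simp at hs
    rw [← Finset.mul_prod_erase _ _ (Finset.mem_univ c),
      ← Finset.mul_prod_erase _ _ (Finset.mem_erase.mpr ⟨h1, Finset.mem_univ _⟩), ← mul_assoc,
      pow_two]
    refine Ideal.mul_mem_right _ _ (Ideal.mul_mem_mul (hc _) ?_)
    simpa using hr (s⁻¹ r)

/-- By the product rule, for `a` and `b` with values at `l` divisible by `q`, both terms of `(a b)'`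
have value at `l` divisible by `q`. -/
theorem eval_mem_of_mem_sq {R : Type*} [CommRing R] (q l : R) (F : R[X])
    (hF : F ∈ ((Ideal.span {q}).comap (evalRingHom l)) ^ 2) :
    q ^ 2 ∣ F.eval l ∧ q ∣ (derivative F).eval l := by
  rw [pow_two] at hF
  induction hF using Submodule.mul_induction_on' with
  | mem_mul_mem a ha b hb =>
    rw [Ideal.mem_comap, Ideal.mem_span_singleton, coe_evalRingHom] at ha hb
    constructor
    · rw [eval_mul, pow_two]; exact mul_dvd_mul ha hb
    · rw [derivative_mul, eval_add, eval_mul, eval_mul]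
      exact dvd_add (hb.mul_left _) (ha.mul_right _)
  | add a _ b _ ha hb =>
    rw [derivative_add, eval_add, eval_add]
    exact ⟨dvd_add ha.1 hb.1, dvd_add ha.2 hb.2⟩

/-- Modulo `q ^ 2` the value `F(l)` is zero and `F'(l)` has square zero, so
`resultant_derivative_eq_zero` applies. -/
theorem sq_dvd_resultant_derivative {R : Type*} [CommRing R] (q l : R) (F : R[X]) (n : ℕ)
    (hn : 2 ≤ n) (hF : F.natDegree ≤ n) (h0 : q ^ 2 ∣ F.eval l)
    (h1 : q ∣ (derivative F).eval l) : q ^ 2 ∣ resultant F (derivative F) n (n - 1) := by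
  rw [← Ideal.mem_span_singleton, ← Ideal.Quotient.eq_zero_iff_mem] at h0 ⊢
  rw [← resultant_map_map, ← derivative_map]
  refine resultant_derivative_eq_zero _ (Ideal.Quotient.mk _ l) n hn
    (natDegree_map_le.trans hF) ?_ ?_
  · rwa [eval_map_apply]
  · rw [derivative_map, eval_map_apply, ← map_pow, Ideal.Quotient.eq_zero_iff_mem,
      Ideal.mem_span_singleton]
    exact pow_dvd_pow_of_dvd h1 2

/-- The characteristic matrix of `A₀ (B + l A₀)`, evaluated at `l`, has a row and a column divisible
by `p` whose common entry is zero. Its determinant therefore has a double zero at `l` in the sense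
of `eval_mem_of_mem_sq`. -/
theorem sqDvdAt_matDisc {p : ℕ} (hp : p.Prime) {n : ℕ} (hn : 2 ≤ n)
    (B : Matrix (Fin n) (Fin n) ℚ) (l : ℤ) (hB : ∀ i j, B i j ∈ localSubring hp)
    (h0 : B ⟨0, by omega⟩ ⟨0, by omega⟩ = 0)
    (hr : ∀ j, ∃ r ∈ localSubring hp, B ⟨0, by omega⟩ j = p * r)
    (hc : ∀ i, ∃ r ∈ localSubring hp, B i ⟨0, by omega⟩ = p * r) :
    SqDvdAt p (matDisc (B + (l : ℚ) • antiDiag n)) := by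
  let R := localSubring hp
  let N : Matrix (Fin n) (Fin n) R := Matrix.of fun i j =>
    ⟨B i.rev j, hB _ _⟩ + (if i = j then (l : R) else 0)
  have hNij : ∀ i j, N i j = ⟨B i.rev j, hB _ _⟩ + (if i = j then (l : R) else 0) :=
    fun _ _ => rfl
  have hN : antiDiag n * (B + (l : ℚ) • antiDiag n) = N.map R.subtype := by
    rw [Matrix.mul_add, Matrix.mul_smul, antiDiag_mul_self]
    ext i j
    rw [Matrix.add_apply, antiDiag_mul_apply, Matrix.smul_apply, Matrix.one_apply,
      Matrix.map_apply, hNij]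
    split_ifs <;> simp
  have hF : invPoly (B + (l : ℚ) • antiDiag n) = N.charpoly.map R.subtype := by
    rw [invPoly_eq_charpoly, hN, Matrix.charpoly_map]
  have hdeg : N.charpoly.natDegree = n := by
    rw [Matrix.charpoly_natDegree_eq_dim, Fintype.card_fin]
  have hmon := N.charpoly_monic
  have hmem : N.charpoly ∈ ((Ideal.span {(p : R)}).comap (evalRingHom (l : R))) ^ 2 := by
    have hent : ∀ i j, N.charmatrix i j =
        (if i = j then X - C (l : R) else 0) - C ⟨B i.rev j, hB _ _⟩ := by
      intro i j
      rw [Matrix.charmatrix_apply, Matrix.diagonal_apply, hNij]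
      split_ifs <;> simp
      ring
    have hmemI : ∀ i j, (∃ r ∈ localSubring hp, B i.rev j = p * r) →
        N.charmatrix i j ∈ (Ideal.span {(p : R)}).comap (evalRingHom (l : R)) := by
      rintro i j ⟨r, hr, hr'⟩
      rw [hent, Ideal.mem_comap, Ideal.mem_span_singleton, coe_evalRingHom]
      refine ⟨-⟨r, hr⟩, ?_⟩
      have : (⟨B i.rev j, hB _ _⟩ : R) = p * ⟨r, hr⟩ := Subtype.ext (by simpa using hr')
      rw [this]
      split_ifs <;> simp
    have hrev : (Fin.rev ⟨n - 1, by omega⟩ : Fin n) = ⟨0, by omega⟩ := by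
      rw [Fin.ext_iff, Fin.val_rev]; simp only; omega
    -- `A₀` moves the first row of `B` to the last place. Since `n ≥ 2`, its crossing with the first
    -- column is off the diagonal and carries no `X`.
    refine det_mem_sq _ _ ⟨n - 1, by omega⟩ ⟨0, by omega⟩ ?_ ?_ ?_
    · rw [hent, if_neg (by rw [Fin.mk.injEq]; omega)]
      simp only [hrev, h0]
      rw [show (⟨0, _⟩ : R) = 0 from rfl]
      simp
    · intro j
      exact hmemI _ _ (hrev ▸ hr j)
    · intro i
      exact hmemI _ _ (hc _)
  obtain ⟨h1, h2⟩ := eval_mem_of_mem_sq _ _ _ hmem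
  obtain ⟨s, hs⟩ := sq_dvd_resultant_derivative _ _ _ n hn hdeg.le h1 h2
  have hdegQ : (N.charpoly.map R.subtype).natDegree = n := by rw [hmon.natDegree_map, hdeg]
  have hres := resultant_deriv (f := N.charpoly.map R.subtype)
    (natDegree_pos_iff_degree_pos.mp (by omega))
  rw [hdegQ, (hmon.map _).leadingCoeff, mul_one, derivative_map, resultant_map_map, hs] at hres
  obtain ⟨a, b, hb, hab⟩ := s.2
  have hsgn : ((-1 : ℚ) ^ (n * (n - 1) / 2)) * (-1) ^ (n * (n - 1) / 2) = 1 := by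
    rw [← mul_pow]; simp
  refine ⟨(-1) ^ (n * (n - 1) / 2) * a, b, hb, ?_⟩
  rw [matDisc, hF]
  push_cast
  rw [← hab]
  simp only [map_mul, map_pow, map_natCast, Subring.subtype_apply] at hres
  linear_combination (-(-1) ^ (n * (n - 1) / 2) * (b : ℚ)) * hres -
    ((b : ℚ) * (N.charpoly.map R.subtype).discr) * hsgn

theorem mem_localSubring_of_mem_lattice {p : ℕ} (hp : p.Prime) {g n d : ℕ} (hd : ¬ p ∣ d)
    {B : Matrix (Fin n) (Fin n) ℚ} (hB : B ∈ W0Lattice g n d) (i j : Fin n) :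
    B i j ∈ localSubring hp := by
  obtain ⟨z, hz⟩ := hB.2 i j
  exact ⟨z, d, by exact_mod_cast hd, by simpa using hz⟩

/-- The perturbation `p B'` is absorbed into `B`: the first row stays divisible by `p`, and the
corner entry stays zero by the definition of `W0`. The term `l A₀` is kept apart because its first
row need not be divisible by `p`. -/
theorem stronglyDvdMatDisc {p : ℕ} (hp : p.Prime) {g n d : ℕ} (hd : ¬ p ∣ d) (hg : 1 ≤ g)
    (hn : g + 1 < n) {B : Matrix (Fin n) (Fin n) ℚ} (hB : B ∈ W0Lattice g n d) (l : ℤ)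
    (hr : ∀ j, ∃ r ∈ localSubring hp, B ⟨0, by omega⟩ j = p * r) :
    StronglyDvdMatDisc (W0Lattice g n d) p (B + (l : ℚ) • antiDiag n) := by
  have key : ∀ B' ∈ W0Lattice g n d,
      SqDvdAt p (matDisc (B + (l : ℚ) • antiDiag n + (p : ℚ) • B')) := by
    intro B' hB'
    rw [add_right_comm]
    have hrow : ∀ j, ∃ r ∈ localSubring hp, (B + (p : ℚ) • B') ⟨0, by omega⟩ j = p * r := by
      intro j
      obtain ⟨r, hr, hr'⟩ := hr j
      refine ⟨r + B' ⟨0, by omega⟩ j,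
        add_mem hr (mem_localSubring_of_mem_lattice hp hd hB' _ _), ?_⟩
      rw [Matrix.add_apply, Matrix.smul_apply, hr', smul_eq_mul, mul_add]
    refine sqDvdAt_matDisc hp (by omega) _ l ?_ ?_ hrow ?_
    · intro i j
      exact add_mem (mem_localSubring_of_mem_lattice hp hd hB _ _)
        (mul_mem (natCast_mem _ p) (mem_localSubring_of_mem_lattice hp hd hB' _ _))
    · rw [Matrix.add_apply, Matrix.smul_apply, hB.1.2 _ _ (show 0 < g by omega) (by simpa using hn),
        hB'.1.2 _ _ (show 0 < g by omega) (by simpa using hn)]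
      simp
    · intro i
      obtain ⟨r, hr, hr'⟩ := hrow i
      refine ⟨r, hr, ?_⟩
      rw [← hr', Matrix.add_apply, Matrix.add_apply, Matrix.smul_apply, Matrix.smul_apply,
        hB.1.1.apply, hB'.1.1.apply]
  refine ⟨?_, key⟩
  have h0 : (0 : Matrix (Fin n) (Fin n) ℚ) ∈ W0Lattice g n d :=
    ⟨⟨Matrix.isSymm_zero, fun _ _ _ _ => rfl⟩, fun _ _ => ⟨0, by simp⟩⟩
  simpa using key 0 h0

theorem antiDiag_mem_lattice (g n d : ℕ) (l : ℤ) :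
    (l : ℚ) • antiDiag n ∈ W0Lattice g n d := by
  refine ⟨⟨?_, ?_⟩, ?_⟩
  · refine Matrix.IsSymm.smul ?_ _
    ext i j
    simp only [Matrix.transpose_apply, antiDiag, Matrix.of_apply, add_comm i.val]
  · intro i j hi hj
    simp only [Matrix.smul_apply, antiDiag, Matrix.of_apply]
    rw [if_neg (by omega)]; simp
  · intro i j
    simp only [Matrix.smul_apply, antiDiag, Matrix.of_apply]
    split_ifs
    · exact ⟨d * l, by simp⟩
    · exact ⟨0, by simp⟩

theorem add_mem_lattice {g n d : ℕ} {A B : Matrix (Fin n) (Fin n) ℚ}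
    (hA : A ∈ W0Lattice g n d) (hB : B ∈ W0Lattice g n d) : A + B ∈ W0Lattice g n d := by
  refine ⟨⟨hA.1.1.add hB.1.1, fun i j hi hj => ?_⟩, fun i j => ?_⟩
  · rw [Matrix.add_apply, hA.1.2 i j hi hj, hB.1.2 i j hi hj, add_zero]
  · obtain ⟨a, ha⟩ := hA.2 i j
    obtain ⟨b, hb⟩ := hB.2 i j
    exact ⟨a + b, by rw [Matrix.add_apply, mul_add, ha, hb]; push_cast; rfl⟩

/-! ### Determinants of bordered tridiagonal matrices -/

/-- The determinant of a matrix that is upper triangular with respect to the order of the indices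
given by an injective function `b`. -/
theorem det_eq_prod_diag_of_injective {ι R : Type*} [CommRing R] [Fintype ι] [DecidableEq ι]
    (M : Matrix ι ι R) (b : ι → ℕ) (hb : Function.Injective b)
    (h : ∀ i j, b j < b i → M i j = 0) : M.det = ∏ i, M i i := by
  let _ : LinearOrder ι := LinearOrder.lift' b hb
  have := Matrix.det_of_isUpperTriangular (M := M) (fun i j hij => h i j hij)
  convert this

theorem sign_revPerm (n : ℕ) :
    Equiv.Perm.sign (Fin.revPerm : Equiv.Perm (Fin n)) = (-1) ^ (n * (n - 1) / 2) := by
  have h1 := Matrix.det_permute' (Fin.revPerm : Equiv.Perm (Fin n)) (1 : Matrix (Fin n) (Fin n) ℚ)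
  have h2 : (1 : Matrix (Fin n) (Fin n) ℚ).submatrix id (Fin.revPerm : Equiv.Perm (Fin n)) =
      antiDiag n := by
    ext i j
    rw [antiDiag_apply, Matrix.submatrix_apply, Matrix.one_apply, id, Fin.revPerm_apply]
    congr 1
    rw [eq_iff_iff, eq_comm, Fin.rev_eq_iff, eq_comm]
  rw [h2, Matrix.det_one, mul_one, det_antiDiag] at h1
  apply Units.ext
  push_cast
  exact_mod_cast h1.symm

theorem sum_tridiagonal {R : Type*} [CommRing R] (d e v : ℕ → R) (N : ℕ) :
    ∑ k ∈ Finset.range (N + 1), v k * ∑ l ∈ Finset.range (N + 1),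
      (if k = l then d k else if l = k + 1 then e k else if k = l + 1 then e l else 0) * v l =
    ∑ k ∈ Finset.range (N + 1), d k * v k ^ 2 +
      2 * ∑ k ∈ Finset.range N, e k * v k * v (k + 1) := by
  induction N with
  | zero => simp; ring
  | succ N ih =>
    rw [Finset.sum_range_succ]
    simp_rw [Finset.sum_range_succ _ (N + 1), mul_add]
    rw [Finset.sum_add_distrib, ih,
      Finset.sum_range_succ (fun k => e k * v k * v (k + 1)) N]
    have h1 : ∑ k ∈ Finset.range (N + 1), v k * ((if k = N + 1 then d k else if N + 1 = k + 1
        then e k else if k = N + 1 + 1 then e (N + 1) else 0) * v (N + 1)) =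
        v N * (e N * v (N + 1)) := by
      rw [Finset.sum_range_succ, Finset.sum_eq_zero]
      · simp
      · intro k hk
        rw [Finset.mem_range] at hk
        rw [if_neg (by omega), if_neg (by omega), if_neg (by omega)]; simp
    have h2 : ∑ l ∈ Finset.range (N + 1), (if N + 1 = l then d (N + 1) else if l = N + 1 + 1 then
        e (N + 1) else if N + 1 = l + 1 then e l else 0) * v l = e N * v N := by
      rw [Finset.sum_range_succ, Finset.sum_eq_zero]
      · rw [if_neg (by omega), if_neg (by omega), if_pos rfl, zero_add]
      · intro k hk
        rw [Finset.mem_range] at hk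
        rw [if_neg (by omega), if_neg (by omega), if_neg (by omega)]; simp
    rw [h1, h2, if_pos trivial]
    ring

/-- The entries of the matrix `((0, T), (Tᵗ, D))` of size `2 g + 1`, where `D` is tridiagonal and
`T` is the `g × (g + 1)` matrix with `x` and `-1` (`-m` in the first row) in each row. -/
def borderEntry {R : Type*} [CommRing R] (g : ℕ) (m x : R) (d e : ℕ → R) (i j : ℕ) : R :=
  if i + j + 1 = 2 * g then (if min i j = 0 then -m else -1)
  else if i + j = 2 * g ∧ i ≠ j then x
  else if i = j ∧ g ≤ i then d (i - g)
  else if j = i + 1 ∧ g ≤ i then e (i - g)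
  else if i = j + 1 ∧ g ≤ j then e (j - g)
  else 0

theorem borderEntry_comm {R : Type*} [CommRing R] (g : ℕ) (m x : R) (d e : ℕ → R) (i j : ℕ) :
    borderEntry g m x d e i j = borderEntry g m x d e j i := by
  unfold borderEntry
  rw [min_comm, add_comm j i]
  by_cases h1 : i = j
  · subst h1; rfl
  · have h2 : ¬ j = i := fun h => h1 h.symm
    simp only [h1, h2, false_and, if_false, ne_eq, not_false_eq_true]
    by_cases h3 : j = i + 1
    · have h4 : ¬ i = j + 1 := by omega
      simp only [h3, true_and]
      have h5 : ¬ i = i + 1 + 1 := by omega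
      simp only [h5, false_and, if_false]
    · simp only [h3, false_and, if_false]

/-- The vector `v = (x ^ g, …, x, m)` is killed by `T`. Replacing the central column and then the
central row by the combinations with coefficients `(0, v)` multiplies the determinant by `x ^ (2
g)`. The new central row and column vanish in their first `g` places and meet in the value of the
form `D` at `v`. The result is triangular after the columns are reversed, with `x` at the other `2
g` pivots. -/
theorem det_borderEntry {R : Type*} [CommRing R] [IsDomain R] {g : ℕ} (hg : 1 ≤ g) (m : R) {x : R}
    (hx : x ≠ 0) (d e v : ℕ → R) (hv : ∀ k < g, v k = x ^ (g - k)) (hvg : v g = m) :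
    (Matrix.of fun i j : Fin (2 * g + 1) => borderEntry g m x d e i j).det =
      (-1) ^ g * (∑ k ∈ Finset.range (g + 1), d k * v k ^ 2 +
        2 * ∑ k ∈ Finset.range g, e k * v k * v (k + 1)) := by
  set G : Matrix (Fin (2 * g + 1)) (Fin (2 * g + 1)) R :=
    Matrix.of fun i j => borderEntry g m x d e i j with hG
  set Q := ∑ k ∈ Finset.range (g + 1), d k * v k ^ 2 +
        2 * ∑ k ∈ Finset.range g, e k * v k * v (k + 1) with hQ
  have hGij : ∀ i j, G i j = borderEntry g m x d e i j := fun _ _ => rfl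
  let V : ℕ → R := fun i => if i < g then 0 else v (i - g)
  let w : ℕ → R := fun i => ∑ j ∈ Finset.range (2 * g + 1), V j * borderEntry g m x d e i j
  have hw0 : ∀ i < g, w i = 0 := by
    intro i hi
    rw [show w i = _ from Finset.sum_eq_add (2 * g - i) (2 * g - 1 - i) (by omega) ?_ ?_ ?_]
    · have h1 : borderEntry g m x d e i (2 * g - i) = x := by
        unfold borderEntry
        rw [if_neg (by omega), if_pos (by omega)]
      have h2 : borderEntry g m x d e i (2 * g - 1 - i) = if i = 0 then -m else -1 := by
        unfold borderEntry
        rw [if_pos (by omega), min_eq_left (by omega)]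
      have h3 : V (2 * g - i) = v (g - i) := by
        simp only [V]; rw [if_neg (by omega)]; congr 1; omega
      have h4 : V (2 * g - 1 - i) = x ^ (i + 1) := by
        simp only [V]; rw [if_neg (by omega), hv _ (by omega)]; congr 1; omega
      rw [h1, h2, h3, h4]
      split_ifs with h0
      · rw [h0, Nat.sub_zero, hvg]; ring
      · rw [hv _ (by omega), show g - (g - i) = i by omega]; ring
    · intro j hj hne
      rw [Finset.mem_range] at hj
      by_cases hjg : j < g
      · simp only [V]; rw [if_pos hjg, zero_mul]
      · unfold borderEntry
        rw [if_neg (by omega), if_neg (by omega), if_neg (by omega), if_neg (by omega),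
          if_neg (by omega), mul_zero]
    · intro h; exact absurd (Finset.mem_range.mpr (by omega)) h
    · intro h; exact absurd (Finset.mem_range.mpr (by omega)) h
  have hsplit : ∀ F : ℕ → R, ∑ i ∈ Finset.range (2 * g + 1), V i * F i =
      ∑ k ∈ Finset.range (g + 1), v k * F (g + k) := by
    intro F
    rw [show 2 * g + 1 = g + (g + 1) by ring, Finset.sum_range_add, Finset.sum_eq_zero, zero_add]
    · refine Finset.sum_congr rfl fun k _ => ?_
      simp only [V]; rw [if_neg (by omega), Nat.add_sub_cancel_left]
    · intro i hi
      rw [Finset.mem_range] at hi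
      simp only [V]; rw [if_pos hi, zero_mul]
  have hVw : ∑ i ∈ Finset.range (2 * g + 1), V i * w i = Q := by
    rw [hsplit, hQ, ← sum_tridiagonal]
    refine Finset.sum_congr rfl fun k _ => ?_
    simp only [w]
    rw [hsplit]
    congr 1
    refine Finset.sum_congr rfl fun l _ => ?_
    rw [mul_comm]
    congr 1
    unfold borderEntry
    rw [if_neg (by omega), if_neg (by omega)]
    by_cases h1 : k = l
    · rw [if_pos (by omega), if_pos h1, Nat.add_sub_cancel_left]
    rw [if_neg (by omega), if_neg h1]
    by_cases h2 : l = k + 1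
    · rw [if_pos (by omega), if_pos h2, Nat.add_sub_cancel_left]
    rw [if_neg (by omega), if_neg h2]
    by_cases h3 : k = l + 1
    · rw [if_pos (by omega), if_pos h3, Nat.add_sub_cancel_left]
    rw [if_neg (by omega), if_neg h3]
  let c : Fin (2 * g + 1) := ⟨g, by omega⟩
  let N₁ := G.updateCol c (fun k => ∑ i : Fin (2 * g + 1), V i • G k i)
  have hN₁ : N₁.det = V c • G.det := Matrix.det_updateCol_sum G c (fun i => V i)
  let N₂ := N₁.updateRow c (∑ i : Fin (2 * g + 1), V i • N₁ i)
  have hN₂ : N₂.det = V c • N₁.det := Matrix.det_updateRow_sum N₁ c (fun i => V i)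
  have hVc : V c = x ^ g := by
    simp only [V, c]
    rw [if_neg (by omega), Nat.sub_self, hv 0 (by omega), Nat.sub_zero]
  have hwF : ∀ k : Fin (2 * g + 1), ∑ i : Fin (2 * g + 1), V i • G k i = w k := by
    intro k
    exact Fin.sum_univ_eq_sum_range (fun j => V j * borderEntry g m x d e k j) (2 * g + 1)
  have hN₁c : ∀ i, N₁ i c = w i := by
    intro i; simp only [N₁]; rw [Matrix.updateCol_self, hwF]
  have hN₁ne : ∀ i j, j ≠ c → N₁ i j = G i j := fun i j h => Matrix.updateCol_ne h
  have hcc : N₂ c c = Q := by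
    simp only [N₂]
    rw [Matrix.updateRow_self, Finset.sum_apply, ← hVw, ← Fin.sum_univ_eq_sum_range (fun i => V i * w i)]
    refine Finset.sum_congr rfl fun i _ => ?_
    rw [Pi.smul_apply, hN₁c, smul_eq_mul]
  have hcj : ∀ j : Fin (2 * g + 1), j.val < g → N₂ c j = 0 := by
    intro j hj
    have hjc : j ≠ c := fun h => by simp [h, c] at hj
    simp only [N₂]
    rw [Matrix.updateRow_self, Finset.sum_apply, ← hw0 _ hj, ← hwF]
    refine Finset.sum_congr rfl fun i _ => ?_
    rw [Pi.smul_apply, hN₁ne _ _ hjc, hGij, hGij, borderEntry_comm]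
  have hic : ∀ i : Fin (2 * g + 1), i.val < g → N₂ i c = 0 := by
    intro i hi
    have hne : i ≠ c := fun h => by simp [h, c] at hi
    simp only [N₂]
    rw [Matrix.updateRow_ne hne, hN₁c, hw0 _ hi]
  have hij : ∀ i j : Fin (2 * g + 1), i.val ≠ g → j.val ≠ g →
      N₂ i j = borderEntry g m x d e i j := by
    intro i j hi hj
    have hi' : i ≠ c := fun h => by simp [h, c] at hi
    have hj' : j ≠ c := fun h => by simp [h, c] at hj
    simp only [N₂]
    rw [Matrix.updateRow_ne hi', hN₁ne _ _ hj', hGij]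
  have htri : (N₂.submatrix id (Fin.revPerm : Equiv.Perm (Fin (2 * g + 1)))).det =
      ∏ i, N₂ i i.rev := by
    refine det_eq_prod_diag_of_injective _
      -- Elimination order: the rows below the centre first, then the central row, then the rows
      -- through the zero block.
      (fun i => if i.val < g then g + 2 + i.val else if i.val = g then g + 1 else i.val - g) ?_ ?_
    · intro i j hij
      rw [Fin.ext_iff]
      simp only at hij
      split_ifs at hij <;> omega
    · intro i j hlt
      have hj := Fin.val_rev j
      rw [Matrix.submatrix_apply, id, Fin.revPerm_apply]
      generalize j.rev = j' at hj
      have := j'.2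
      have hi2 := i.2
      replace hlt : (if j.val < g then g + 2 + j.val else if j.val = g then g + 1 else j.val - g) <
        (if i.val < g then g + 2 + i.val else if i.val = g then g + 1 else i.val - g) := hlt
      rcases lt_trichotomy i.val g with hi | hi | hi
      · by_cases hj' : j'.val = g
        · rw [show j' = c from Fin.ext hj', hic _ hi]
        · rw [hij _ _ hi.ne hj']
          rw [if_pos hi] at hlt
          unfold borderEntry
          split_ifs at hlt <;>
          rw [if_neg (by omega), if_neg (by omega), if_neg (by omega), if_neg (by omega),
            if_neg (by omega)]
      · rw [show i = c from Fin.ext hi]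
        apply hcj
        split_ifs at hlt <;> omega
      · rw [if_neg (show ¬ i.val < g by omega), if_neg (show ¬ i.val = g by omega)] at hlt
        have hjg : j'.val < g ∧ j.val < i.val := by split_ifs at hlt <;> omega
        rw [hij _ _ hi.ne' hjg.1.ne]
        unfold borderEntry
        rw [if_neg (by omega), if_neg (by omega), if_neg (by omega), if_neg (by omega),
          if_neg (by omega)]
  have hprod : ∏ i, N₂ i i.rev = Q * x ^ (2 * g) := by
    rw [← Finset.mul_prod_erase _ _ (Finset.mem_univ c)]
    have hrc : c.rev = c := by
      rw [Fin.ext_iff, Fin.val_rev]; simp only [c]; omega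
    rw [hrc, hcc]
    congr 1
    rw [Finset.prod_congr rfl (g := fun _ => x)]
    · rw [Finset.prod_const, Finset.card_erase_of_mem (Finset.mem_univ _), Finset.card_univ,
        Fintype.card_fin]
      rfl
    · intro i hi
      have hi' : i.val ≠ g := fun h => (Finset.mem_erase.mp hi).1 (Fin.ext h)
      have h2 := Fin.val_rev i
      rw [hij _ _ hi' (by omega)]
      unfold borderEntry
      rw [if_neg (by omega), if_pos (by omega)]
  rw [Matrix.det_permute', sign_revPerm, hN₂, hN₁, hVc, hprod] at htri
  have hexp : (-1 : ℤˣ) ^ ((2 * g + 1) * (2 * g + 1 - 1) / 2) = (-1) ^ g := by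
    rw [show (2 * g + 1) * (2 * g + 1 - 1) / 2 = 2 * (g * g) + g by
      rw [Nat.add_sub_cancel, show (2 * g + 1) * (2 * g) = 2 * (2 * (g * g) + g) by ring]
      simp, pow_add, pow_mul]
    simp
  rw [hexp] at htri
  push_cast at htri
  have hsgn : ((-1 : R) ^ g) * (-1) ^ g = 1 := by rw [← mul_pow]; simp
  -- The factor `x ^ (2 g)` appears on both sides: once from the two replacements, once from the
  -- pivots.
  apply mul_left_cancel₀ (pow_ne_zero (2 * g) hx)
  simp only [smul_eq_mul] at htri
  linear_combination ((-1) ^ g) * htri - (x ^ (2 * g) * G.det) * hsgn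

theorem sum_Icc_odd_even {R : Type*} [CommRing R] (a : ℕ → R) (h : ℕ) :
    ∑ i ∈ Finset.Icc 1 (2 * h + 1), a i =
      ∑ k ∈ Finset.range (h + 1), a (2 * k + 1) + ∑ k ∈ Finset.range h, a (2 * k + 2) := by
  induction h with
  | zero => simp
  | succ h ih =>
    rw [show 2 * (h + 1) + 1 = 2 * h + 1 + 1 + 1 by ring, Finset.sum_Icc_succ_top (by omega),
      Finset.sum_Icc_succ_top (by omega), ih,
      Finset.sum_range_succ (fun k => a (2 * k + 1)) (h + 1),
      Finset.sum_range_succ (fun k => a (2 * k + 2)) h, show 2 * (h + 1) + 1 = 2 * h + 1 + 1 + 1 by ring]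
    ring

/-- Diagonal entries meet the even powers of `x` and off-diagonal ones the odd powers, so `a i`
lands on `x ^ (2 g + 1 - i)`, except that the last coordinate `m` of the vector alters the last two
terms. The parameter `t` carries the leading part: `X` for odd size, `X ^ 2 + c₁ X` for even size.
-/
theorem det_borderEntry_eq_normalForm {R : Type*} [CommRing R] [IsDomain R] {g : ℕ} (hg : 1 ≤ g)
    (m : R) {x : R} (hx : x ≠ 0) (t : R) (d e a : ℕ → R) (hd0 : d 0 = t + a 1)
    (hd : ∀ k, 1 ≤ k → d k = a (2 * k + 1)) (he : ∀ k, 2 * e k = a (2 * k + 2)) :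
    (Matrix.of fun i j : Fin (2 * g + 1) => borderEntry g m x d e i j).det =
      (-1) ^ g * (t * x ^ (2 * g) + ∑ i ∈ Finset.Icc 1 (2 * g - 1), a i * x ^ (2 * g + 1 - i) +
        m * a (2 * g) * x + m ^ 2 * a (2 * g + 1)) := by
  rw [det_borderEntry hg m hx d e (fun k => if k < g then x ^ (g - k) else m)
    (fun k hk => if_pos hk) (if_neg (lt_irrefl _))]
  congr 1
  obtain ⟨h, rfl⟩ := Nat.exists_eq_add_of_le' hg
  rw [Finset.mul_sum, show 2 * (h + 1) - 1 = 2 * h + 1 by omega, sum_Icc_odd_even,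
    Finset.sum_range_succ _ (h + 1)]
  have h2 : ∑ k ∈ Finset.range (h + 1), d k * (if k < h + 1 then x ^ (h + 1 - k) else m) ^ 2 =
      t * x ^ (2 * (h + 1)) +
        ∑ k ∈ Finset.range (h + 1), a (2 * k + 1) * x ^ (2 * (h + 1) + 1 - (2 * k + 1)) := by
    rw [Finset.sum_range_succ', Finset.sum_range_succ' (n := h)]
    rw [hd0, if_pos (by omega)]
    have : ∀ k ∈ Finset.range h,
        d (k + 1) * (if k + 1 < h + 1 then x ^ (h + 1 - (k + 1)) else m) ^ 2 =
        a (2 * (k + 1) + 1) * x ^ (2 * (h + 1) + 1 - (2 * (k + 1) + 1)) := by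
      intro k hk
      rw [Finset.mem_range] at hk
      rw [hd _ (by omega), if_pos (by omega), ← pow_mul]
      congr 2; omega
    rw [Finset.sum_congr rfl this, ← pow_mul]
    simp only [Nat.sub_zero, mul_zero, zero_add, Nat.add_sub_cancel]
    ring
  have h3 : ∑ k ∈ Finset.range (h + 1), 2 * (e k * (if k < h + 1 then x ^ (h + 1 - k) else m) *
      (if k + 1 < h + 1 then x ^ (h + 1 - (k + 1)) else m)) =
      ∑ k ∈ Finset.range h, a (2 * k + 2) * x ^ (2 * (h + 1) + 1 - (2 * k + 2)) +
        2 * (e h * x * m) := by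
    rw [Finset.sum_range_succ, if_pos (by omega), if_neg (by omega),
      show h + 1 - h = 1 by omega, pow_one]
    congr 1
    refine Finset.sum_congr rfl fun k hk => ?_
    rw [Finset.mem_range] at hk
    rw [if_pos (by omega), if_pos (by omega), ← he,
      show 2 * (h + 1) + 1 - (2 * k + 2) = (h + 1 - k) + (h + 1 - (k + 1)) by omega, pow_add]
    ring
  rw [h2, h3, if_neg (by omega), hd _ (by omega)]
  linear_combination (x * m) * he h

/-! ### The explicit matrices and their invariant polynomials -/

theorem isSymm_of_min_max {R : Type*} {n : ℕ} (F : ℕ → ℕ → R) :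
    (Matrix.of fun i j : Fin n => F (min i.val j.val) (max i.val j.val)).IsSymm := by
  ext i j
  simp only [Matrix.transpose_apply, Matrix.of_apply]
  rw [min_comm, max_comm]

theorem oddMatrix_isSymm (g m : ℕ) (c : ℕ → ℤ) : (oddMatrix g m c).IsSymm :=
  isSymm_of_min_max (fun a b => if a + b + 2 = 2 * g + 1 then (if a = 0 then (m : ℚ) else 1)
    else if a = b ∧ g ≤ a then -(c (2 * (a - g) + 1) : ℚ)
    else if b = a + 1 ∧ g ≤ a then -(c (2 * (a - g) + 2) : ℚ) / 2
    else 0)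

theorem evenMatrix_isSymm (g m : ℕ) (c : ℕ → ℤ) : (evenMatrix g m c).IsSymm :=
  isSymm_of_min_max (fun a b => if a + b + 2 = 2 * g + 2 then (if a = 0 then (m : ℚ) else 1)
    else if a = b ∧ a = g + 1 then (c 1 : ℚ) ^ 2 / 4 - (c 2 : ℚ)
    else if a = b ∧ g + 1 < a then -(c (2 * (a - g)) : ℚ)
    else if b = a + 1 ∧ g ≤ a then -(c (2 * (a - g) + 1) : ℚ) / 2
    else 0)

theorem oddMatrix_apply_of_le {g m : ℕ} {c : ℕ → ℤ} {i j : Fin (2 * g + 1)} (h : i.val ≤ j.val) :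
    oddMatrix g m c i j =
      if i.val + j.val + 2 = 2 * g + 1 then (if i.val = 0 then (m : ℚ) else 1)
      else if i.val = j.val ∧ g ≤ i.val then -(c (2 * (i.val - g) + 1) : ℚ)
      else if j.val = i.val + 1 ∧ g ≤ i.val then -(c (2 * (i.val - g) + 2) : ℚ) / 2
      else 0 := by
  simp only [oddMatrix, Matrix.of_apply, min_eq_left h, max_eq_right h]

theorem evenMatrix_apply_of_le {g m : ℕ} {c : ℕ → ℤ} {i j : Fin (2 * g + 2)} (h : i.val ≤ j.val) :
    evenMatrix g m c i j =
      if i.val + j.val + 2 = 2 * g + 2 then (if i.val = 0 then (m : ℚ) else 1)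
      else if i.val = j.val ∧ i.val = g + 1 then (c 1 : ℚ) ^ 2 / 4 - (c 2 : ℚ)
      else if i.val = j.val ∧ g + 1 < i.val then -(c (2 * (i.val - g)) : ℚ)
      else if j.val = i.val + 1 ∧ g ≤ i.val then -(c (2 * (i.val - g) + 1) : ℚ) / 2
      else 0 := by
  simp only [evenMatrix, Matrix.of_apply, min_eq_left h, max_eq_right h]

theorem oddMatrix_mem_lattice (g m : ℕ) (c : ℕ → ℤ) :
    oddMatrix g m c ∈ W0Lattice g (2 * g + 1) 2 := by
  refine ⟨⟨oddMatrix_isSymm g m c, ?_⟩, ?_⟩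
  · intro i j hi hj
    simp only [oddMatrix, Matrix.of_apply]
    rw [if_neg (by omega), if_neg (by omega), if_neg (by omega)]
  · intro i j
    simp only [oddMatrix, Matrix.of_apply]
    split_ifs
    · exact ⟨2 * m, by push_cast; ring⟩
    · exact ⟨2, by push_cast; ring⟩
    · exact ⟨2 * -c (2 * (min i.val j.val - g) + 1), by push_cast; ring⟩
    · exact ⟨-c (2 * (min i.val j.val - g) + 2), by push_cast; ring⟩
    · exact ⟨0, by simp⟩

theorem evenMatrix_mem_lattice (g m : ℕ) (c : ℕ → ℤ) :
    evenMatrix g m c ∈ W0Lattice g (2 * g + 2) 4 := by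
  refine ⟨⟨evenMatrix_isSymm g m c, ?_⟩, ?_⟩
  · intro i j hi hj
    simp only [evenMatrix, Matrix.of_apply]
    rw [if_neg (by omega), if_neg (by omega), if_neg (by omega), if_neg (by omega)]
  · intro i j
    simp only [evenMatrix, Matrix.of_apply]
    split_ifs
    · exact ⟨4 * m, by push_cast; ring⟩
    · exact ⟨4, by push_cast; ring⟩
    · exact ⟨c 1 ^ 2 - 4 * c 2, by push_cast; ring⟩
    · exact ⟨-4 * c (2 * (min i.val j.val - g)), by push_cast; ring⟩
    · exact ⟨-2 * c (2 * (min i.val j.val - g) + 1), by push_cast; ring⟩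
    · exact ⟨0, by simp⟩

theorem oddMatrix_zero_row {g m : ℕ} (hg : 1 ≤ g) (c : ℕ → ℤ) (j : Fin (2 * g + 1)) :
    oddMatrix g m c ⟨0, by omega⟩ j = m * (if j.val + 2 = 2 * g + 1 then 1 else 0) := by
  rw [oddMatrix_apply_of_le (Nat.zero_le _)]
  dsimp only
  rw [zero_add, if_pos rfl,
    if_neg (show ¬ (0 = j.val ∧ g ≤ 0) by omega),
    if_neg (show ¬ (j.val = 0 + 1 ∧ g ≤ 0) by omega)]
  split_ifs <;> simp

theorem evenMatrix_zero_row {g m : ℕ} (hg : 1 ≤ g) (c : ℕ → ℤ) (j : Fin (2 * g + 2)) :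
    evenMatrix g m c ⟨0, by omega⟩ j = m * (if j.val + 2 = 2 * g + 2 then 1 else 0) := by
  rw [evenMatrix_apply_of_le (Nat.zero_le _)]
  dsimp only
  rw [zero_add, if_pos rfl,
    if_neg (show ¬ (0 = j.val ∧ 0 = g + 1) by omega),
    if_neg (show ¬ (0 = j.val ∧ g + 1 < 0) by omega),
    if_neg (show ¬ (j.val = 0 + 1 ∧ g ≤ 0) by omega)]
  split_ifs <;> simp

theorem map_normalForm (n m : ℕ) (c : ℕ → ℤ) :
    (normalForm n m c).map (Int.castRingHom ℚ) =
      X ^ n + ∑ i ∈ Finset.Icc 1 (n - 2), C (c i : ℚ) * X ^ (n - i) +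
        C (m : ℚ) * C (c (n - 1) : ℚ) * X + C (m : ℚ) ^ 2 * C (c n : ℚ) := by
  simp [normalForm, Polynomial.map_sum]

theorem pencil_apply {n : ℕ} (B : Matrix (Fin n) (Fin n) ℚ) (i j : Fin n) :
    ((X : ℚ[X]) • (antiDiag n).map C - B.map C) i j =
      (if i.val + j.val + 1 = n then X else 0) - C (B i j) := by
  simp only [Matrix.sub_apply, Matrix.smul_apply, Matrix.map_apply, antiDiag, Matrix.of_apply]
  split_ifs <;> simp

theorem pencil_comm {n : ℕ} {B : Matrix (Fin n) (Fin n) ℚ} (hB : B.IsSymm) (i j : Fin n) :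
    ((X : ℚ[X]) • (antiDiag n).map C - B.map C) i j =
      ((X : ℚ[X]) • (antiDiag n).map C - B.map C) j i := by
  rw [pencil_apply, pencil_apply, hB.apply i j, add_comm i.val]

theorem invPoly_oddMatrix {g : ℕ} (hg : 1 ≤ g) (m : ℕ) (c : ℕ → ℤ) :
    invPoly (oddMatrix g m c) = (normalForm (2 * g + 1) m c).map (Int.castRingHom ℚ) := by
  -- For odd size the anti-diagonal passes through the centre, which puts an `X` into the first
  -- entry of the tridiagonal block.
  let d : ℕ → ℚ[X] := fun k => (if k = 0 then X else 0) + C (c (2 * k + 1) : ℚ)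
  let e : ℕ → ℚ[X] := fun k => C ((c (2 * k + 2) : ℚ) / 2)
  have hmat : (X : ℚ[X]) • (antiDiag (2 * g + 1)).map C - (oddMatrix g m c).map C =
      Matrix.of fun i j : Fin (2 * g + 1) => borderEntry g (C (m : ℚ)) X d e i j := by
    have key : ∀ i j : Fin (2 * g + 1), i.val ≤ j.val →
        ((X : ℚ[X]) • (antiDiag (2 * g + 1)).map C - (oddMatrix g m c).map C) i j =
          borderEntry g (C (m : ℚ)) X d e i j := by
      intro i j hij
      rw [pencil_apply, oddMatrix_apply_of_le hij, borderEntry, min_eq_left hij]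
      by_cases h1 : i.val + j.val + 1 = 2 * g
      · rw [if_neg (by omega), if_pos (by omega), if_pos h1]
        split_ifs <;> simp
      rw [if_neg (by omega : ¬ (i.val + j.val + 2 = 2 * g + 1)), if_neg h1]
      by_cases h2 : i.val + j.val = 2 * g ∧ i.val ≠ j.val
      · rw [if_pos (by omega), if_neg (by omega), if_neg (by omega), if_pos h2]
        simp
      rw [if_neg h2]
      by_cases h3 : i.val = j.val ∧ g ≤ i.val
      · rw [if_pos h3, if_pos h3]
        by_cases h4 : i.val = g
        · rw [if_pos (by omega)]; simp [d, h4]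
        · rw [if_neg (by omega)]
          simp [d, show i.val - g ≠ 0 by omega]
      rw [if_neg h3, if_neg h3, if_neg (by omega)]
      by_cases h4 : j.val = i.val + 1 ∧ g ≤ i.val
      · rw [if_pos h4, if_pos h4]
        simp only [e]
        rw [neg_div, C_neg]; ring
      rw [if_neg h4, if_neg h4, if_neg (by omega)]
      simp
    ext1 i j
    rcases le_total i.val j.val with h | h
    · exact key i j h
    · rw [pencil_comm (oddMatrix_isSymm g m c), key j i h, borderEntry_comm]; rfl
  rw [invPoly, hmat, det_borderEntry_eq_normalForm hg _ X_ne_zero X d e (fun i => C (c i : ℚ)),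
    map_normalForm]
  · have hexp : (-1 : ℚ[X]) ^ ((2 * g + 1) * (2 * g + 1 - 1) / 2) = (-1) ^ g := by
      rw [show (2 * g + 1) * (2 * g + 1 - 1) / 2 = 2 * (g * g) + g by
        rw [Nat.add_sub_cancel, show (2 * g + 1) * (2 * g) = 2 * (2 * (g * g) + g) by ring]
        simp, pow_add, pow_mul]
      simp
    rw [hexp, ← mul_assoc, ← mul_pow]
    simp only [neg_mul_neg, one_mul, one_pow, Nat.add_sub_cancel,
      show 2 * g + 1 - 2 = 2 * g - 1 by omega]
    ring
  · simp [d]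
  · intro k hk
    simp [d, show k ≠ 0 by omega]
  · intro k
    simp only [e]
    rw [← C_ofNat, ← C_mul]
    congr 1; ring

/-- In the pencil, row `g` has only the pivot `-1` and next to it `y = X + c₁ / 2`. Eliminating with
it adds `y ^ 2` to `c₂ - c₁ ^ 2 / 4`, giving `X ^ 2 + c₁ X + c₂`; this explains the entry `c₁ ^ 2 /
4 - c₂`. What remains is the bordered shape of size `2 g + 1` with the coefficients shifted by one.
-/
theorem invPoly_evenMatrix {g : ℕ} (hg : 1 ≤ g) (m : ℕ) (c : ℕ → ℤ) :
    invPoly (evenMatrix g m c) = (normalForm (2 * g + 2) m c).map (Int.castRingHom ℚ) := by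
  let t : ℚ[X] := X ^ 2 + C (c 1 : ℚ) * X
  let d : ℕ → ℚ[X] := fun k => (if k = 0 then t else 0) + C (c (2 * k + 2) : ℚ)
  let e : ℕ → ℚ[X] := fun k => C ((c (2 * k + 3) : ℚ) / 2)
  let y : ℚ[X] := X + C ((c 1 : ℚ) / 2)
  set N := (X : ℚ[X]) • (antiDiag (2 * g + 2)).map C - (evenMatrix g m c).map C with hN
  have hsymm : ∀ i j, N i j = N j i := pencil_comm (evenMatrix_isSymm g m c)
  have hent : ∀ i j : Fin (2 * g + 2), i.val ≤ j.val → N i j = _ := fun i j h =>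
    (pencil_apply _ i j).trans (by rw [evenMatrix_apply_of_le h])
  let p : Fin (2 * g + 1 + 1) := ⟨g, by omega⟩
  let r : Fin (2 * g + 1 + 1) := ⟨g + 1, by omega⟩
  have hpv : p.val = g := rfl
  have hrv : r.val = g + 1 := rfl
  have hpr : r ≠ p := by simp [p, r]
  have hpp : N p p = -1 := by
    rw [hent _ _ le_rfl, hpv, if_neg (by omega), if_pos (by omega), if_neg (by omega)]; simp
  have hprE : N p r = y := by
    rw [hent _ _ (by omega), hpv, hrv, if_pos (by omega), if_neg (by omega), if_neg (by omega), if_neg (by omega),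
      if_pos (by omega)]
    simp [y, neg_div]
  have hpj : ∀ j, j ≠ p → j ≠ r → N p j = 0 := by
    intro j h1 h2
    have h1' : j.val ≠ g := fun h => h1 (Fin.ext h)
    have h2' : j.val ≠ g + 1 := fun h => h2 (Fin.ext h)
    rcases le_total p.val j.val with h | h
    · rw [hent _ _ h, hpv, if_neg (by omega), if_neg (by omega), if_neg (by omega), if_neg (by omega),
        if_neg (by omega)]; simp
    · rw [hsymm, hent _ _ h, hpv, if_neg (by omega), if_neg (by omega), if_neg (by omega), if_neg (by omega),
        if_neg (by omega)]; simp
  let N' := N.updateRow r (N r + y • N p)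
  have hdet : N'.det = N.det := Matrix.det_updateRow_add_smul_self N hpr y
  have hN'r : ∀ j, N' r j = N r j + y * N p j := by
    intro j
    simp only [N']
    rw [Matrix.updateRow_self]; rfl
  have hN'ne : ∀ i j, i ≠ r → N' i j = N i j := by
    intro i j hi
    simp only [N']
    rw [Matrix.updateRow_ne hi]
  have hcol : ∀ i, i ≠ p → N' i p = 0 := by
    intro i hi
    by_cases hir : i = r
    · rw [hir, hN'r, hpp, hsymm, hprE]; ring
    · rw [hN'ne _ _ hir, hsymm, hpj _ hi hir]
  have hsub : N'.submatrix p.succAbove p.succAbove =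
      Matrix.of fun i j : Fin (2 * g + 1) => borderEntry g (C (m : ℚ)) X d e i j := by
    -- Away from row and column `p`, the elimination changes only the entry at `(r, r)`.
    have hN'' : ∀ i j, i ≠ p → j ≠ p → N' i j = N i j + if i = r ∧ j = r then y ^ 2 else 0 := by
      intro i j hi hj
      by_cases hir : i = r
      · by_cases hjr : j = r
        · rw [hir, hjr, hN'r, hprE, if_pos ⟨rfl, rfl⟩]; ring
        · rw [hir, hN'r, hpj _ hj hjr, if_neg (by simp [hjr])]; ring
      · rw [hN'ne _ _ hir, if_neg (by simp [hir]), add_zero]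
    have hval : ∀ i : Fin (2 * g + 1), (p.succAbove i).val = if i.val < g then i.val else i.val + 1 := by
      intro i
      by_cases h : i.val < g
      · rw [Fin.succAbove_of_castSucc_lt _ _ (by simpa [Fin.lt_def, p] using h), if_pos h]; rfl
      · rw [Fin.succAbove_of_le_castSucc _ _ (by simpa [Fin.le_def, p] using h), if_neg h]; rfl
    have key : ∀ i j : Fin (2 * g + 1), i.val ≤ j.val →
        N' (p.succAbove i) (p.succAbove j) = borderEntry g (C (m : ℚ)) X d e i j := by
      intro i j hij
      rw [hN'' _ _ (Fin.succAbove_ne _ _) (Fin.succAbove_ne _ _)]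
      have hi := hval i
      have hj := hval j
      have hi2 := i.2
      have hj2 := j.2
      generalize p.succAbove i = i' at hi
      generalize p.succAbove j = j' at hj
      have hij' : i'.val ≤ j'.val := by split_ifs at hi hj <;> omega
      have hr : (i' = r ∧ j' = r) ↔ (i.val = g ∧ j.val = g) := by
        simp only [Fin.ext_iff, r]
        split_ifs at hi hj <;> omega
      have hr' : (if i' = r ∧ j' = r then y ^ 2 else 0) =
          if i.val = g ∧ j.val = g then y ^ 2 else 0 := if_congr hr rfl rfl
      rw [hr', hent _ _ hij', borderEntry, min_eq_left hij]
      by_cases h1 : i.val + j.val + 1 = 2 * g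
      · have h0 : i'.val = i.val := by split_ifs at hi <;> omega
        have h0' : j'.val = j.val + 1 := by split_ifs at hj <;> omega
        rw [if_neg (by omega), if_pos (by omega), if_pos h1, if_neg (show ¬ (i.val = g ∧ j.val = g) by omega), h0]
        split_ifs <;> simp
      rw [if_neg (by split_ifs at hi hj <;> omega : ¬ (i'.val + j'.val + 2 = 2 * g + 2)), if_neg h1]
      by_cases h2 : i.val + j.val = 2 * g ∧ i.val ≠ j.val
      · have h0 : i'.val = i.val := by split_ifs at hi <;> omega
        have h0' : j'.val = j.val + 1 := by split_ifs at hj <;> omega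
        rw [if_pos (by omega), if_neg (by omega), if_neg (by omega), if_neg (by omega), if_pos h2,
          if_neg (show ¬ (i.val = g ∧ j.val = g) by omega)]
        simp
      rw [if_neg h2]
      by_cases h3 : i.val = j.val ∧ g ≤ i.val
      · have h0 : i'.val = i.val + 1 := by split_ifs at hi <;> omega
        have h0' : j'.val = j.val + 1 := by split_ifs at hj <;> omega
        rw [if_pos h3, if_neg (by omega)]
        by_cases h4 : i.val = g
        · rw [if_pos (by omega), if_pos (show i.val = g ∧ j.val = g by omega), h4, Nat.sub_self]
          simp only [d, t, y, if_true, mul_zero, zero_add]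
          have h5 : (C ((c 1 : ℚ)) : ℚ[X]) = 2 * C ((c 1 : ℚ) / 2) := by
            rw [← C_ofNat, ← C_mul]; congr 1; ring
          have h6 : (C ((c 1 : ℚ) ^ 2 / 4) : ℚ[X]) = C ((c 1 : ℚ) / 2) ^ 2 := by
            rw [← C_pow]; congr 1; ring
          rw [C_sub, h6, h5]; ring
        · rw [if_neg (by omega), if_pos (by omega), if_neg (show ¬ (i.val = g ∧ j.val = g) by omega), h0,
            show 2 * (i.val + 1 - g) = 2 * (i.val - g) + 2 by omega]
          simp [d, show i.val - g ≠ 0 by omega]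
      rw [if_neg h3]
      rw [if_neg (by split_ifs at hi hj <;> omega), if_neg (by split_ifs at hi hj <;> omega),
        if_neg (by split_ifs at hi hj <;> omega), if_neg (show ¬ (i.val = g ∧ j.val = g) by omega)]
      by_cases h4 : j.val = i.val + 1 ∧ g ≤ i.val
      · have h0 : i'.val = i.val + 1 := by split_ifs at hi <;> omega
        have h0' : j'.val = j.val + 1 := by split_ifs at hj <;> omega
        rw [if_pos (by omega), if_pos h4, h0,
          show 2 * (i.val + 1 - g) + 1 = 2 * (i.val - g) + 3 by omega]
        simp only [e]
        rw [neg_div, C_neg]; ring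
      rw [if_neg (by split_ifs at hi hj <;> omega), if_neg h4, if_neg (by omega)]
      simp
    ext1 i j
    rcases le_total i.val j.val with h | h
    · exact key i j h
    · have h1 : N' (p.succAbove i) (p.succAbove j) = N' (p.succAbove j) (p.succAbove i) := by
        rw [hN'' _ _ (Fin.succAbove_ne _ _) (Fin.succAbove_ne _ _),
          hN'' _ _ (Fin.succAbove_ne _ _) (Fin.succAbove_ne _ _), hsymm]
        simp only [and_comm]
      rw [Matrix.submatrix_apply, h1, key j i h, borderEntry_comm]; rfl
  have hdetN : N.det = -(Matrix.of fun i j : Fin (2 * g + 1) =>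
      borderEntry g (C (m : ℚ)) X d e i j).det := by
    rw [← hdet, Matrix.det_succ_column N' p, Finset.sum_eq_single p, hsub, hN'ne _ _ hpr.symm, hpp]
    · rw [← two_mul, pow_mul]; simp
    · intro i _ hi
      rw [hcol i hi]; ring
    · simp
  rw [invPoly, ← hN, hdetN,
    det_borderEntry_eq_normalForm hg _ X_ne_zero t d e (fun i => C (c (i + 1) : ℚ)),
    map_normalForm]
  · have hexp : (-1 : ℚ[X]) ^ ((2 * g + 2) * (2 * g + 2 - 1) / 2) = -(-1) ^ g := by
      rw [show (2 * g + 2) * (2 * g + 2 - 1) / 2 = 2 * (g * g + g) + g + 1 by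
        rw [show (2 * g + 2) * (2 * g + 2 - 1) = 2 * (2 * (g * g + g) + g + 1) by
          rw [show 2 * g + 2 - 1 = 2 * g + 1 by omega]; ring]
        simp, pow_succ, pow_add, pow_mul]
      simp
    have hs : ((-1 : ℚ[X]) ^ g) * (-1) ^ g = 1 := by rw [← mul_pow]; simp
    have hsum : ∑ i ∈ Finset.Icc 1 (2 * g + 2 - 2), C (c i : ℚ) * (X : ℚ[X]) ^ (2 * g + 2 - i) =
        C (c 1 : ℚ) * X ^ (2 * g + 1) +
        ∑ i ∈ Finset.Icc 1 (2 * g - 1), C (c (i + 1) : ℚ) * X ^ (2 * g + 1 - i) := by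
      rw [Nat.add_sub_cancel, ← Finset.add_sum_Ioc_eq_sum_Icc (by omega)]
      congr 1
      refine Finset.sum_nbij' (fun i => i - 1) (fun i => i + 1) ?_ ?_ ?_ ?_ ?_
      · intro i hi; simp only [Finset.mem_Icc, Finset.mem_Ioc] at *; omega
      · intro i hi; simp only [Finset.mem_Icc, Finset.mem_Ioc] at *; omega
      · intro i hi; simp only [Finset.mem_Ioc] at *; omega
      · intro i hi; simp only [Finset.mem_Icc] at *; omega
      · intro i hi
        simp only [Finset.mem_Ioc] at hi
        rw [show i - 1 + 1 = i by omega, show 2 * g + 1 - (i - 1) = 2 * g + 2 - i by omega]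
    rw [hexp, hsum, show 2 * g + 2 - 1 = 2 * g + 1 by omega]
    simp only [t]
    linear_combination ((X ^ 2 + C (c 1 : ℚ) * X) * X ^ (2 * g) +
      ∑ i ∈ Finset.Icc 1 (2 * g - 1), C (c (i + 1) : ℚ) * X ^ (2 * g + 1 - i) +
      C (m : ℚ) * C (c (2 * g + 1) : ℚ) * X + C (m : ℚ) ^ 2 * C (c (2 * g + 1 + 1) : ℚ)) * hs
  · simp [d]
  · intro k hk
    simp [d, show k ≠ 0 by omega]
  · intro k
    simp only [e]
    rw [← C_ofNat, ← C_mul]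
    congr 1; ring

/-! ### The `Q`-invariant -/

/-- With its rows reversed the block is bidiagonal. Deleting column `j` splits it into an upper
triangular part with diagonal `-1` and a lower triangular part with diagonal `X - l`. The entry `-m`
is in the last reversed row, so it is on the diagonal only for `j = g`. -/
theorem det_minor_bidiagonal {g : ℕ} (hg : 1 ≤ g) (m l : ℚ)
    (T : Matrix (Fin g) (Fin (g + 1)) ℚ[X])
    (hT : ∀ i j, T i j = (if i.val + j.val = g then X - C l else 0) -
      (if i.val + j.val + 1 = g then (if i.val = 0 then C m else 1) else 0)) (j : Fin (g + 1)) :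
    ((T.submatrix id j.succAbove).submatrix (Fin.revPerm : Equiv.Perm (Fin g)) id).det =
      (-1) ^ j.val * (if j.val = g then C m else (X - C l) ^ (g - j.val)) := by
  have hval : ∀ b : Fin g, (j.succAbove b).val = if b.val < j.val then b.val else b.val + 1 := by
    intro b
    by_cases h : b.val < j.val
    · rw [Fin.succAbove_of_castSucc_lt _ _ (by simpa [Fin.lt_def] using h), if_pos h]; rfl
    · rw [Fin.succAbove_of_le_castSucc _ _ (by simpa [Fin.le_def] using h), if_neg h]; rfl
  have hent : ∀ a b : Fin g,
      (T.submatrix id j.succAbove).submatrix (Fin.revPerm : Equiv.Perm (Fin g)) id a b =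
      (if (j.succAbove b).val = a.val + 1 then X - C l else 0) -
      (if (j.succAbove b).val = a.val then (if g - 1 - a.val = 0 then C m else 1) else 0) := by
    intro a b
    have ha := a.2
    rw [Matrix.submatrix_apply, Matrix.submatrix_apply, hT, id, id, Fin.revPerm_apply,
      Fin.val_rev]
    refine congr_arg₂ _ (if_congr (by omega) rfl rfl) (if_congr (by omega) (if_congr (by omega) rfl
      rfl) rfl)
  rw [det_eq_prod_diag_of_injective _
    -- The indices from `j` on are reversed because the second part is lower triangular.
    (fun a => if a.val < j.val then a.val else 2 * g - a.val) ?_ ?_]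
  · have hdiag : ∀ a : Fin g, (T.submatrix id j.succAbove).submatrix
        (Fin.revPerm : Equiv.Perm (Fin g)) id a a =
        if a.val < j.val then -(if g - 1 - a.val = 0 then C m else 1) else X - C l := by
      intro a
      have h1 := hval a
      rw [hent]
      split_ifs at h1 ⊢ <;> first | omega | simp
    rw [Finset.prod_congr rfl (fun a _ => hdiag a), Fin.prod_univ_eq_prod_range
      (fun a => if a < j.val then -(if g - 1 - a = 0 then C m else 1) else X - C l) g]
    have hj := j.2
    by_cases h : j.val = g
    · rw [if_pos h, h]
      obtain ⟨k, rfl⟩ := Nat.exists_eq_add_of_le' hg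
      rw [Finset.prod_range_succ, if_pos (by omega), if_pos (by omega),
        Finset.prod_congr rfl (g := fun _ => (-1 : ℚ[X])), Finset.prod_const, Finset.card_range]
      · ring
      · intro a ha
        rw [Finset.mem_range] at ha
        rw [if_pos (by omega), if_neg (by omega)]
    · rw [if_neg h]
      obtain ⟨t, ht⟩ := Nat.exists_eq_add_of_le (show j.val ≤ g by omega)
      have e1 : g - j.val = t := by omega
      rw [e1]
      rw [show Finset.range g = Finset.range (j.val + t) by rw [← ht], Finset.prod_range_add]
      congr 1
      · rw [Finset.prod_congr rfl (g := fun _ => (-1 : ℚ[X])), Finset.prod_const, Finset.card_range]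
        intro a ha
        rw [Finset.mem_range] at ha
        rw [if_pos (by omega), if_neg (by omega)]
      · rw [Finset.prod_congr rfl (g := fun _ => X - C l), Finset.prod_const, Finset.card_range]
        intro a ha
        rw [if_neg (by omega)]
  · intro a b hab
    have ha := a.2
    have hb := b.2
    rw [Fin.ext_iff]
    simp only at hab
    split_ifs at hab <;> omega
  · intro a b hab
    have ha := a.2
    have hb := b.2
    have h1 := hval b
    rw [hent, if_neg, if_neg, sub_zero]
    · split_ifs at hab h1 <;> omega
    · split_ifs at hab h1 <;> omega

/-- The sign `(-1) ^ j` of the minor cancels the one in `signedMinor`. In reversed order the forms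
are `m, X - l, …, (X - l) ^ g` up to a common sign, so their coefficient matrix is triangular with
diagonal `m, 1, …, 1`. -/
theorem abs_pairQ {g : ℕ} (hg : 1 ≤ g) (m : ℕ) (l : ℚ) (A B : Matrix (Fin g) (Fin (g + 1)) ℚ)
    (hA : ∀ i j, A i j = if i.val + j.val = g then 1 else 0)
    (hB : ∀ i j, B i j = (if i.val + j.val + 1 = g then (if i.val = 0 then (m : ℚ) else 1) else 0) +
      l * (if i.val + j.val = g then 1 else 0)) : |pairQ A B| = m := by
  obtain ⟨s, hs, hs'⟩ : ∃ s : ℚ, |s| = 1 ∧ ∀ j, signedMinor A B j =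
      C s * (if j.val = g then C (m : ℚ) else (X - C l) ^ (g - j.val)) := by
    refine ⟨((Equiv.Perm.sign (Fin.revPerm : Equiv.Perm (Fin g)) : ℤ) : ℚ), ?_, ?_⟩
    · rcases Int.units_eq_one_or (Equiv.Perm.sign (Fin.revPerm : Equiv.Perm (Fin g))) with h | h <;>
        simp [h]
    · intro j
      have h1 := det_minor_bidiagonal hg (m : ℚ) l ((X : ℚ[X]) • A.map C - B.map C) (by
        intro i j
        rw [Matrix.sub_apply, Matrix.smul_apply, Matrix.map_apply, Matrix.map_apply, hA, hB]
        split_ifs <;> simp <;> ring) j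
      rw [Matrix.det_permute] at h1
      rw [signedMinor]
      have h2 : ((-1 : ℚ[X]) ^ j.val) * (-1) ^ j.val = 1 := by rw [← mul_pow]; simp
      generalize (((X : ℚ[X]) • A.map C - B.map C).submatrix id j.succAbove).det = D at h1 ⊢
      generalize (if j.val = g then C (m : ℚ) else (X - C l) ^ (g - j.val)) = w at h1 ⊢
      rcases Int.units_eq_one_or (Equiv.Perm.sign (Fin.revPerm : Equiv.Perm (Fin g))) with h | h <;>
        rw [h] at h1 ⊢ <;> simp at h1 ⊢
      · rw [h1, ← mul_assoc, h2, one_mul]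
      · rw [neg_eq_iff_eq_neg.mp h1, mul_neg, ← mul_assoc, h2, one_mul]
  have h3 := Matrix.det_permute (Fin.revPerm : Equiv.Perm (Fin (g + 1)))
    (Matrix.of fun i k : Fin (g + 1) => (signedMinor A B i).coeff k.val)
  have h4 : ∀ i k : Fin (g + 1), (Matrix.of fun i k : Fin (g + 1) =>
      (signedMinor A B i).coeff k.val).submatrix (Fin.revPerm : Equiv.Perm (Fin (g + 1))) id i k =
      s * (if i.val = 0 then C (m : ℚ) else (X - C l) ^ i.val).coeff k.val := by
    intro i k
    have hi := i.2
    rw [Matrix.submatrix_apply, Matrix.of_apply, hs', coeff_C_mul, id, Fin.revPerm_apply,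
      Fin.val_rev]
    by_cases h0 : i.val = 0
    · rw [if_pos h0, if_pos (by omega)]
    · rw [if_neg h0, if_neg (by omega), show g - (g + 1 - (i.val + 1)) = i.val by omega]
  rw [det_eq_prod_diag_of_injective _ (fun i => g - i.val) ?_ ?_] at h3
  · rw [Finset.prod_congr rfl (g := fun i : Fin (g + 1) => s * if i.val = 0 then (m : ℚ) else 1),
      Finset.prod_mul_distrib, Finset.prod_const, Fin.prod_univ_succ] at h3
    · have h5 := congrArg abs h3
      have h6 : |((Equiv.Perm.sign (Fin.revPerm : Equiv.Perm (Fin (g + 1))) : ℤ) : ℚ)| = 1 := by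
        rcases Int.units_eq_one_or (Equiv.Perm.sign (Fin.revPerm : Equiv.Perm (Fin (g + 1))))
          with h | h <;> simp [h]
      rw [abs_mul, abs_mul (a := ((Equiv.Perm.sign _ : ℤ) : ℚ)), abs_pow, hs, h6, one_pow, one_mul,
        one_mul] at h5
      rw [pairQ, ← h5]
      simp
    · intro i _
      rw [h4]
      by_cases h0 : i.val = 0
      · rw [if_pos h0, if_pos h0, h0]; simp
      · rw [if_neg h0, if_neg h0]
        have := (monic_X_sub_C l).pow i.val
        have h7 : ((X - C l) ^ i.val).natDegree = i.val := by simp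
        have h8 := this.coeff_natDegree
        rw [h7] at h8
        rw [h8]
  · intro i j hij
    have hi := i.2
    have hj := j.2
    rw [Fin.ext_iff]
    simp only at hij
    omega
  · intro i j hij
    rw [h4]
    by_cases h0 : i.val = 0
    · rw [if_pos h0, coeff_C_of_ne_zero (by omega), mul_zero]
    · rw [if_neg h0, coeff_eq_zero_of_natDegree_lt, mul_zero]
      rw [natDegree_pow, natDegree_X_sub_C]
      omega

theorem abs_matQ {n g : ℕ} (hg : 1 ≤ g) (hn : g + 1 ≤ n) (m : ℕ) (l : ℚ)
    (B : Matrix (Fin n) (Fin n) ℚ)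
    (hB : ∀ i j : Fin n, i.val < g → n - (g + 1) ≤ j.val →
      B i j = if i.val + j.val + 2 = n then (if i.val = 0 then (m : ℚ) else 1) else 0) :
    |matQ g hn (B + l • antiDiag n)| = m := by
  refine abs_pairQ hg m l _ _ ?_ ?_
  · intro i j
    have hi := i.2
    simp only [topRight, antiDiag, Matrix.of_apply]
    exact if_congr (by omega) rfl rfl
  · intro i j
    have hi := i.2
    have hj := j.2
    simp only [topRight, antiDiag, Matrix.of_apply, Matrix.add_apply, Matrix.smul_apply,
      smul_eq_mul]
    rw [hB _ _ hi (Nat.le_add_right _ _)]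
    congr 1
    · exact if_congr (by simp only; omega) rfl rfl
    · congr 1
      exact if_congr (by omega) rfl rfl

theorem matQ_oddMatrix {g : ℕ} (hg : 1 ≤ g) (m : ℕ) (c : ℕ → ℤ) (l : ℚ)
    (hn : g + 1 ≤ 2 * g + 1) :
    |matQ g hn (oddMatrix g m c + l • antiDiag (2 * g + 1))| = m := by
  refine abs_matQ hg hn m l _ fun i j hi hj => ?_
  rw [oddMatrix_apply_of_le (by omega), if_neg (show ¬ (i.val = j.val ∧ g ≤ i.val) by omega),
    if_neg (show ¬ (j.val = i.val + 1 ∧ g ≤ i.val) by omega)]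

theorem matQ_evenMatrix {g : ℕ} (hg : 1 ≤ g) (m : ℕ) (c : ℕ → ℤ) (l : ℚ)
    (hn : g + 1 ≤ 2 * g + 2) :
    |matQ g hn (evenMatrix g m c + l • antiDiag (2 * g + 2))| = m := by
  refine abs_matQ hg hn m l _ fun i j hi hj => ?_
  rw [evenMatrix_apply_of_le (by omega),
    if_neg (show ¬ (i.val = j.val ∧ i.val = g + 1) by omega),
    if_neg (show ¬ (i.val = j.val ∧ g + 1 < i.val) by omega),
    if_neg (show ¬ (j.val = i.val + 1 ∧ g ≤ i.val) by omega)]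

/-! ### Assembly of the map -/

theorem invPoly_eq_map_of_comp {n : ℕ} {B : Matrix (Fin n) (Fin n) ℚ} {f F : ℤ[X]} {l : ℤ}
    (hF : f.comp (X + C l) = F) (hB : invPoly B = F.map (Int.castRingHom ℚ)) :
    invPoly (B + (l : ℚ) • antiDiag n) = f.map (Int.castRingHom ℚ) := by
  rw [invPoly_add_smul_antiDiag, hB, ← hF, Polynomial.map_comp, Polynomial.comp_assoc]
  simp

theorem ne_two_of_mem_weakSet {n m p : ℕ} (hn : 2 ≤ n) {f : ℤ[X]} (hf : f ∈ weakSet n m)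
    (hp : p.Prime) (hpm : p ∣ m) : p ≠ 2 :=
  (exists_zero_of_weaklyDvdDisc hp hf.1 (hf.2.1 ▸ hn) (hf.2.2 p hp hpm)).1

theorem exists_mul_localSubring {p m : ℕ} (hp : p.Prime) (hpm : p ∣ m) {P : Prop} [Decidable P] :
    ∃ r ∈ localSubring hp, (m : ℚ) * (if P then 1 else 0) = p * r := by
  obtain ⟨k, rfl⟩ := hpm
  refine ⟨k * (if P then 1 else 0), mul_mem (natCast_mem _ _) ?_, by push_cast; ring⟩
  split_ifs
  · exact one_mem _
  · exact zero_mem _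

end SquarefreeDisc

end

theorem mainTheorem8 (g : ℕ) (hg : 1 ≤ g) (m : ℕ) (hm : Squarefree m) :
    (∃ σ : ↥(SquarefreeDisc.weakSet (2 * g + 1) m) →
        ↥(SquarefreeDisc.W0Lattice g (2 * g + 1) 2),
      ∀ f : ↥(SquarefreeDisc.weakSet (2 * g + 1) m),
        (∃ (l : ℤ) (c : ℕ → ℤ),
          (f : Polynomial ℤ).comp (Polynomial.X + Polynomial.C l) =
              SquarefreeDisc.normalForm (2 * g + 1) m c ∧
            (σ f : Matrix (Fin (2 * g + 1)) (Fin (2 * g + 1)) ℚ) =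
              SquarefreeDisc.oddMatrix g m c + (l : ℚ) • SquarefreeDisc.antiDiag (2 * g + 1)) ∧
        SquarefreeDisc.invPoly (σ f : Matrix (Fin (2 * g + 1)) (Fin (2 * g + 1)) ℚ) =
          (f : Polynomial ℤ).map (Int.castRingHom ℚ) ∧
        (∀ p : ℕ, p.Prime → p ∣ m →
          SquarefreeDisc.StronglyDvdMatDisc (SquarefreeDisc.W0Lattice g (2 * g + 1) 2) p
            (σ f : Matrix (Fin (2 * g + 1)) (Fin (2 * g + 1)) ℚ)) ∧
        |SquarefreeDisc.matQ g (by omega)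
          (σ f : Matrix (Fin (2 * g + 1)) (Fin (2 * g + 1)) ℚ)| = (m : ℚ)) ∧
    (∃ σ : ↥(SquarefreeDisc.weakSet (2 * g + 2) m) →
        ↥(SquarefreeDisc.W0Lattice g (2 * g + 2) 4),
      ∀ f : ↥(SquarefreeDisc.weakSet (2 * g + 2) m),
        (∃ (l : ℤ) (c : ℕ → ℤ),
          (f : Polynomial ℤ).comp (Polynomial.X + Polynomial.C l) =
              SquarefreeDisc.normalForm (2 * g + 2) m c ∧
            (σ f : Matrix (Fin (2 * g + 2)) (Fin (2 * g + 2)) ℚ) =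
              SquarefreeDisc.evenMatrix g m c + (l : ℚ) • SquarefreeDisc.antiDiag (2 * g + 2)) ∧
        SquarefreeDisc.invPoly (σ f : Matrix (Fin (2 * g + 2)) (Fin (2 * g + 2)) ℚ) =
          (f : Polynomial ℤ).map (Int.castRingHom ℚ) ∧
        (∀ p : ℕ, p.Prime → p ∣ m →
          SquarefreeDisc.StronglyDvdMatDisc (SquarefreeDisc.W0Lattice g (2 * g + 2) 4) p
            (σ f : Matrix (Fin (2 * g + 2)) (Fin (2 * g + 2)) ℚ)) ∧
        |SquarefreeDisc.matQ g (by omega)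
          (σ f : Matrix (Fin (2 * g + 2)) (Fin (2 * g + 2)) ℚ)| = (m : ℚ)) := by
  constructor
  · choose! l c hlc using fun (f : SquarefreeDisc.weakSet (2 * g + 1) m) =>
      SquarefreeDisc.exists_normalForm hm (by omega) f.2
    refine ⟨fun f => ⟨SquarefreeDisc.oddMatrix g m (c f) +
      (l f : ℚ) • SquarefreeDisc.antiDiag (2 * g + 1), SquarefreeDisc.add_mem_lattice
        (SquarefreeDisc.oddMatrix_mem_lattice g m (c f))
        (SquarefreeDisc.antiDiag_mem_lattice _ _ _ _)⟩, fun f => ⟨⟨l f, c f, hlc f, rfl⟩,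
      SquarefreeDisc.invPoly_eq_map_of_comp (hlc f) (SquarefreeDisc.invPoly_oddMatrix hg m (c f)),
      fun p hp hpm => ?_, SquarefreeDisc.matQ_oddMatrix hg m (c f) (l f) _⟩⟩
    -- Since `p` is odd, the denominator `d` of the lattice is a unit at `p`.
    have hp2 := SquarefreeDisc.ne_two_of_mem_weakSet (by omega) f.2 hp hpm
    refine SquarefreeDisc.stronglyDvdMatDisc hp
      (fun h => hp2 ((Nat.prime_dvd_prime_iff_eq hp Nat.prime_two).mp h)) hg (by omega)
      (SquarefreeDisc.oddMatrix_mem_lattice g m (c f)) (l f) fun j => ?_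
    rw [SquarefreeDisc.oddMatrix_zero_row hg]
    exact SquarefreeDisc.exists_mul_localSubring hp hpm
  · choose! l c hlc using fun (f : SquarefreeDisc.weakSet (2 * g + 2) m) =>
      SquarefreeDisc.exists_normalForm hm (by omega) f.2
    refine ⟨fun f => ⟨SquarefreeDisc.evenMatrix g m (c f) +
      (l f : ℚ) • SquarefreeDisc.antiDiag (2 * g + 2), SquarefreeDisc.add_mem_lattice
        (SquarefreeDisc.evenMatrix_mem_lattice g m (c f))
        (SquarefreeDisc.antiDiag_mem_lattice _ _ _ _)⟩, fun f => ⟨⟨l f, c f, hlc f, rfl⟩,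
      SquarefreeDisc.invPoly_eq_map_of_comp (hlc f) (SquarefreeDisc.invPoly_evenMatrix hg m (c f)),
      fun p hp hpm => ?_, SquarefreeDisc.matQ_evenMatrix hg m (c f) (l f) _⟩⟩
    have hp2 := SquarefreeDisc.ne_two_of_mem_weakSet (by omega) f.2 hp hpm
    refine SquarefreeDisc.stronglyDvdMatDisc hp
      (fun h => hp2 ((Nat.prime_dvd_prime_iff_eq hp Nat.prime_two).mp
        (hp.dvd_of_dvd_pow (m := 2) (n := 2) h))) hg (by omega)
      (SquarefreeDisc.evenMatrix_mem_lattice g m (c f)) (l f) fun j => ?_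
    rw [SquarefreeDisc.evenMatrix_zero_row hg]
    exact SquarefreeDisc.exists_mul_localSubring hp hpm
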